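/- Let $S$ be a $d$-dimensional quantum system whose Hamiltonian $H$ (a Hermitian $d\times d$ matrix) is non-trivial, meaning that it has at least three distinct eigenvalues, and let $\beta\in\mathbb R$. Write $\mathcal E(\rho)=\operatorname{tr}(\rho H)$, let $[e]_H$ be the set of all density matrices $\rho$ with $\operatorname{tr}(\rho H)=e$, and for a Hermitian matrix $K$ write $\gamma_\beta(K)=e^{-\beta K}/\operatorname{tr}(e^{-\beta K})$ and $e_\beta(K)=\operatorname{tr}(\gamma_\beta(K)K)$. The canonical ensemble $\gamma_e(H)$ is the Gibbs state $\gamma_b(H)$, $b\in\mathbb R$, with $\mathcal E(\gamma_b(H))=e$. An environment consists of finitely many finite-dimensional systems $E^1,\dots,E^N$ with Hamiltonians $H_{E^1},\dots,H_{E^N}$, and $H_E$ is the sum of the $H_{E^i}$, each acting on its own tensor factor. A density matrix $\rho_f$ of $S$ is reachable from the macrostate $(e,H)$ by commuting macrostate operations if for every $\epsilon>0$ there are an environment and a unitary $U$ on $SE$ with $[U,H\otimes 1+1\otimes H_E]=0$ such that $$\Big\|\rho_f-\operatorname{Tr}_E\Big(U\big(\rho\otimes\textstyle\bigotimes_{i}\rho_i\big)U^\dagger\Big)\Big\|_1\le\epsilon$$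 for all $\rho\in[e]_H$ and all $\rho_i\in[e_\beta(H_{E^i})]_{H_{E^i}}$. It is reachable from a microstate $\rho$ by commuting microstate operations if for every $\epsilon>0$ there are an environment and a unitary $U$ with $[U,H\otimes 1+1\otimes H_E]=0$ such that $$\Big\|\rho_f-\operatorname{Tr}_E\Big(U\big(\rho\otimes\textstyle\bigotimes_{i}\gamma_\beta(H_{E^i})\big)U^\dagger\Big)\Big\|_1\le\epsilon .$$ The macrostate $(e,H)$ and the microstate $\rho$ are operationally equivalent, $(e,H)\overset{c}{\sim}_\beta\rho$, if exactly the same $\rho_f$ are reachable from $(e,H)$ by commuting macrostate operations as from $\rho$ by commuting microstate operations. Then there is an energy $e$, for which $\gamma_e(H)$ exists, such that $$(e,H)\overset{c}{\nsim}_\beta\gamma_e(H).$$ Moreover, for the same $e$, both of the following maxima exist and $$\max\{\mathcal E(\rho_f):\rho_f\text{ reachable from }(e,H)\text{ by commuting macrostate operations}\}<\max\{\mathcal E(\rho_f):\rho_f\text{ reachable from }\gamma_e(H)\text{ by commuting microstate operations}\}.$$ -/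

import Mathlib

open scoped Kronecker ComplexOrder

noncomputable section

namespace ExactEnergy

/-- Density matrices. -/
def IsDensity {n : Type*} [Fintype n] (ρ : Matrix n n ℂ) : Prop :=
  ρ.PosSemidef ∧ ρ.trace = 1

/-- The mean energy `tr (ρ H)`; it is a real number when `ρ` and `H` are Hermitian. -/
def meanEnergy {n : Type*} [Fintype n] (H ρ : Matrix n n ℂ) : ℝ :=
  (ρ * H).trace.re

/-- The equivalence class `[e]_H`: all density matrices whose mean energy with respect to `H`
is `e`. -/
def macrostate {n : Type*} [Fintype n] (e : ℝ) (H : Matrix n n ℂ) : Set (Matrix n n ℂ) :=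
  {ρ | IsDensity ρ ∧ meanEnergy H ρ = e}

/-- The Gibbs state `exp (-β H) / tr (exp (-β H))`. -/
def gibbs {n : Type*} [Fintype n] [DecidableEq n] (β : ℝ) (H : Matrix n n ℂ) : Matrix n n ℂ :=
  (NormedSpace.exp ((-β : ℂ) • H)).trace⁻¹ • NormedSpace.exp ((-β : ℂ) • H)

/-- The thermal energy `e_β(H)`. -/
def thermalEnergy {n : Type*} [Fintype n] [DecidableEq n] (β : ℝ) (H : Matrix n n ℂ) : ℝ :=
  meanEnergy H (gibbs β H)

/-- `γ` is the canonical ensemble `γ_e(H)`: the Gibbs state of `H` (at some inverse temperature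
`b`) whose mean energy is `e`. -/
def IsCanonicalEnsemble {n : Type*} [Fintype n] [DecidableEq n] (H : Matrix n n ℂ) (e : ℝ)
    (γ : Matrix n n ℂ) : Prop :=
  ∃ b : ℝ, γ = gibbs b H ∧ meanEnergy H γ = e

/-- The trace norm: the sum of the singular values. -/
def traceNorm {n : Type*} [Fintype n] [DecidableEq n] (A : Matrix n n ℂ) : ℝ :=
  ∑ i, Real.sqrt ((Matrix.isHermitian_conjTranspose_mul_self A).eigenvalues i)

/-- The partial trace over the second factor. -/
def partialTrace {n m : Type*} [Fintype m] (A : Matrix (n × m) (n × m) ℂ) : Matrix n n ℂ :=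
  Matrix.of fun i j => ∑ k, A (i, k) (j, k)

/-- An environment: finitely many finite-dimensional systems, each with a Hamiltonian. -/
structure Environment where
  /-- the number of systems -/
  N : ℕ
  /-- the dimensions of their Hilbert spaces -/
  dim : Fin N → ℕ
  dim_pos : ∀ i, 0 < dim i
  /-- their Hamiltonians -/
  ham : ∀ i, Matrix (Fin (dim i)) (Fin (dim i)) ℂ
  ham_herm : ∀ i, (ham i).IsHermitian

namespace Environment

/-- Index set of the product basis of the Hilbert space of the environment. -/
abbrev Idx (E : Environment) : Type := ∀ i, Fin (E.dim i)

/-- The tensor product `A 0 ⊗ A 1 ⊗ ⋯` of operators on the systems of the environment. -/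
def tensor (E : Environment) (A : ∀ i, Matrix (Fin (E.dim i)) (Fin (E.dim i)) ℂ) :
    Matrix E.Idx E.Idx ℂ :=
  Matrix.of fun x y => ∏ i, A i (x i) (y i)

/-- The Hamiltonian of the environment, `∑ i, 1 ⊗ ⋯ ⊗ H_i ⊗ ⋯ ⊗ 1`. -/
def hamiltonian (E : Environment) : Matrix E.Idx E.Idx ℂ :=
  ∑ i, E.tensor (Function.update (fun _ => 1) i (E.ham i))

/-- The Hamiltonian `H ⊗ 1 + 1 ⊗ H_E` of system and environment. -/
def totalHamiltonian (E : Environment) {n : Type*} [DecidableEq n] (H : Matrix n n ℂ) :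
    Matrix (n × E.Idx) (n × E.Idx) ℂ :=
  H ⊗ₖ (1 : Matrix E.Idx E.Idx ℂ) + (1 : Matrix n n ℂ) ⊗ₖ E.hamiltonian

/-- The final state `Tr_E (U (ρ ⊗ ρ_1 ⊗ ⋯ ⊗ ρ_N) U†)` of the system. -/
def evolve (E : Environment) {n : Type*} [Fintype n]
    (U : Matrix (n × E.Idx) (n × E.Idx) ℂ) (ρ : Matrix n n ℂ)
    (ρE : ∀ i, Matrix (Fin (E.dim i)) (Fin (E.dim i)) ℂ) : Matrix n n ℂ :=
  partialTrace (U * (ρ ⊗ₖ E.tensor ρE) * U.conjTranspose)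

end Environment

/-- `ρf` can be reached from the macrostate `(e, H)` by commuting macrostate operations with
environments at inverse temperature `β`. -/
def CommutingMacro {n : Type*} [Fintype n] [DecidableEq n] (β e : ℝ) (H ρf : Matrix n n ℂ) :
    Prop :=
  IsDensity ρf ∧ ∀ ε : ℝ, 0 < ε →
    ∃ E : Environment, ∃ U ∈ Matrix.unitaryGroup (n × E.Idx) ℂ,
      Commute U (E.totalHamiltonian H) ∧
      ∀ ρ ∈ macrostate e H,
        ∀ ρE : (∀ i, Matrix (Fin (E.dim i)) (Fin (E.dim i)) ℂ),
          (∀ i, ρE i ∈ macrostate (thermalEnergy β (E.ham i)) (E.ham i)) →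
          traceNorm (ρf - E.evolve U ρ ρE) ≤ ε

/-- `ρf` can be reached from the microstate `ρ` of a system with Hamiltonian `H` by commuting
microstate operations with environments at inverse temperature `β`. -/
def CommutingMicro {n : Type*} [Fintype n] [DecidableEq n] (β : ℝ) (H ρ ρf : Matrix n n ℂ) :
    Prop :=
  IsDensity ρf ∧ ∀ ε : ℝ, 0 < ε →
    ∃ E : Environment, ∃ U ∈ Matrix.unitaryGroup (n × E.Idx) ℂ,
      Commute U (E.totalHamiltonian H) ∧
      traceNorm (ρf - E.evolve U ρ (fun i => gibbs β (E.ham i))) ≤ ε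

/-- Operational equivalence of the macrostate `(e, H)` and the microstate `ρ` under commuting
operations. -/
def CommutingEquiv {n : Type*} [Fintype n] [DecidableEq n] (β e : ℝ) (H ρ : Matrix n n ℂ) :
    Prop :=
  ∀ ρf : Matrix n n ℂ, CommutingMacro β e H ρf ↔ CommutingMicro β H ρ ρf

end ExactEnergy

end

set_option linter.unusedSectionVars false

open Matrix

/-! ### Positive semidefinite matrices -/

namespace Matrix

/-! Take for `γ` the Gibbs state at inverse temperature `β - 1` and for `e` its mean energy, which
exceeds the energy `g` of the Gibbs state at `β`. As a microstate `γ` reaches itself, so energy `e`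
is attained. It remains to show that every state reachable from the macrostate has energy strictly
below `e`.

A macrostate operation must work with one unitary for all states of energy `e`. With the environment
in its Gibbs states and diagonal inputs, the populations of the output depend on those of the input
through a positive linear map `Φ` which fixes the Boltzmann distribution `γ_β`
(`Environment.evolve_gibbs`) and sends every distribution of energy `e` close to one distribution
`r`. Mixing `γ_β` with the top level up to energy `e` gives `r ≥ (1 - t) γ_β`. As `Φ` is nearly
constant on energy `e`, by linearity it also sends distributions of energy `g` close to `γ_β`;
mixing one of energy `e` with the bottom level gives `γ_β ≥ (1 - l) r`. If `r` had energy at least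
`e`, the first bound would be tight below the top level and the second above the bottom level. Both
would be tight at a middle level, which is absurd. This is `sum_mul_lt_of_positive_maps`.

The maxima exist because the reachable sets are closed in the compact set of density matrices, but
the macrostate's set must also be shown nonempty. `commutingMacro_gibbs` reaches the Gibbs state at
`β`: the environment consists of nondegenerate qubits, whose mean energy already fixes their
populations. The system is swapped with a register of qubits having exactly one excitation, and
further, nearly unbiased qubits supply random signs that suppress the coherences. -/

theorem PosSemidef.exists_eq_conjTranspose_mul_self {n : Type*} [Fintype n]
    {A : Matrix n n ℂ} (hA : A.PosSemidef) : ∃ B : Matrix n n ℂ, A = Bᴴ * B := by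
  classical
  open scoped MatrixOrder in
  exact CStarAlgebra.nonneg_iff_eq_star_mul_self.mp hA.nonneg

/-- Off-diagonal entries of a positive semidefinite matrix are bounded by the diagonal. -/
theorem PosSemidef.norm_apply_le {n : Type*} [Fintype n]
    {A : Matrix n n ℂ} (hA : A.PosSemidef) (i j : n) :
    ‖A i j‖ ≤ ((A i i).re + (A j j).re) / 2 := by
  obtain ⟨B, rfl⟩ := hA.exists_eq_conjTranspose_mul_self
  have hd : ∀ i, ((Bᴴ * B) i i).re = ∑ k, ‖B k i‖ ^ 2 := by
    intro i
    simp only [mul_apply, conjTranspose_apply, Complex.re_sum]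
    refine Finset.sum_congr rfl fun k _ => ?_
    rw [RCLike.star_def, ← Complex.normSq_eq_conj_mul_self, Complex.ofReal_re, Complex.normSq_eq_norm_sq]
  rw [hd, hd, ← Finset.sum_add_distrib, Finset.sum_div, mul_apply]
  refine (norm_sum_le _ _).trans (Finset.sum_le_sum fun k _ => ?_)
  rw [conjTranspose_apply, norm_mul, norm_star]
  nlinarith [sq_nonneg (‖B k i‖ - ‖B k j‖)]

theorem PosSemidef.re_diag_nonneg {n : Type*} [Fintype n]
    {A : Matrix n n ℂ} (hA : A.PosSemidef) (i : n) : 0 ≤ (A i i).re :=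
  (Complex.le_def.mp (hA.diag_nonneg (i := i))).1

theorem PosSemidef.ofReal_re_diag {n : Type*} [Fintype n]
    {A : Matrix n n ℂ} (hA : A.PosSemidef) (i : n) : (((A i i).re : ℝ) : ℂ) = A i i := by
  have := (Complex.le_def.mp (hA.diag_nonneg (i := i))).2
  apply Complex.ext <;> simp at this ⊢
  exact this

/-- A tensor product of positive semidefinite matrices is positive semidefinite. -/
theorem PosSemidef.prod_apply {ι : Type*} [Fintype ι] [DecidableEq ι] {κ : ι → Type*}
    [∀ i, Fintype (κ i)] {A : ∀ i, Matrix (κ i) (κ i) ℂ} (hA : ∀ i, (A i).PosSemidef) :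
    (of fun x y : ∀ i, κ i => ∏ i, A i (x i) (y i)).PosSemidef := by
  choose B hB using fun i => (hA i).exists_eq_conjTranspose_mul_self
  have : (of fun x y : ∀ i, κ i => ∏ i, A i (x i) (y i)) =
      (of fun x y : ∀ i, κ i => ∏ i, B i (x i) (y i))ᴴ *
        of fun x y : ∀ i, κ i => ∏ i, B i (x i) (y i) := by
    ext x y
    simp only [of_apply, mul_apply, conjTranspose_apply, star_prod, ← Finset.prod_mul_distrib]
    rw [← Fintype.piFinset_univ,
      ← Finset.prod_univ_sum (fun _ => Finset.univ) fun i z => star (B i z (x i)) * B i z (y i)]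
    refine Finset.prod_congr rfl fun i _ => ?_
    conv_lhs => rw [hB i]
    simp [mul_apply]
  rw [this]
  exact posSemidef_conjTranspose_mul_self _

end Matrix

namespace ExactEnergy

/-! ### Comparison of the trace norm with matrix entries -/

section TraceNorm

variable {n : Type*} [Fintype n] [DecidableEq n]

theorem sum_eigenvalues_conjTranspose_mul_self (A : Matrix n n ℂ) :
    ∑ i, (isHermitian_conjTranspose_mul_self A).eigenvalues i = ∑ i, ∑ j, ‖A j i‖ ^ 2 := by
  have h := (isHermitian_conjTranspose_mul_self A).trace_eq_sum_eigenvalues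
  have h2 := congrArg Complex.re h
  simp only [Complex.re_sum, trace, diag_apply, mul_apply, conjTranspose_apply] at h2
  have h3 : ∀ i, ((Complex.ofReal ((isHermitian_conjTranspose_mul_self A).eigenvalues i))).re =
    (isHermitian_conjTranspose_mul_self A).eigenvalues i := fun i => Complex.ofReal_re _
  refine Eq.trans (Finset.sum_congr rfl fun i _ => (h3 i).symm) (h2.symm.trans ?_)
  refine Finset.sum_congr rfl fun i _ => Finset.sum_congr rfl fun k _ => ?_
  rw [RCLike.star_def, ← Complex.normSq_eq_conj_mul_self, Complex.ofReal_re,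
    Complex.normSq_eq_norm_sq]

/-- The Frobenius norm lies in between: the sum of the squared singular values is at most the square
of their sum. -/
theorem norm_apply_le_traceNorm (A : Matrix n n ℂ) (i j : n) : ‖A i j‖ ≤ traceNorm A := by
  have hnn : ∀ i, 0 ≤ (isHermitian_conjTranspose_mul_self A).eigenvalues i :=
    (posSemidef_conjTranspose_mul_self A).eigenvalues_nonneg
  have h0 : 0 ≤ traceNorm A := Finset.sum_nonneg fun i _ => Real.sqrt_nonneg _
  refine abs_le_of_sq_le_sq' ?_ h0 |>.2
  have h1 : ‖A i j‖ ^ 2 ≤ ∑ i, ∑ j, ‖A j i‖ ^ 2 := by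
    refine le_trans ?_ (Finset.single_le_sum (f := fun i => ∑ j, ‖A j i‖ ^ 2)
      (fun k _ => Finset.sum_nonneg fun l _ => sq_nonneg _) (Finset.mem_univ j))
    exact Finset.single_le_sum (f := fun i => ‖A i j‖ ^ 2) (fun k _ => sq_nonneg _)
      (Finset.mem_univ i)
  refine h1.trans ?_
  rw [← sum_eigenvalues_conjTranspose_mul_self]
  unfold traceNorm
  refine le_trans (le_of_eq (Finset.sum_congr rfl fun i _ => (Real.sq_sqrt (hnn i)).symm)) ?_
  exact Finset.sum_sq_le_sq_sum_of_nonneg fun i _ => Real.sqrt_nonneg _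

/-- Each singular value is bounded by the Frobenius norm. The constant is crude, which is harmless
because tolerances are arbitrary. -/
theorem traceNorm_le_of_norm_apply_le {A : Matrix n n ℂ} {δ : ℝ} (hδ : 0 ≤ δ)
    (h : ∀ i j, ‖A i j‖ ≤ δ) : traceNorm A ≤ (Fintype.card n : ℝ) ^ 2 * δ := by
  have hnn : ∀ i, 0 ≤ (isHermitian_conjTranspose_mul_self A).eigenvalues i :=
    (posSemidef_conjTranspose_mul_self A).eigenvalues_nonneg
  have h1 : ∀ i, √((isHermitian_conjTranspose_mul_self A).eigenvalues i) ≤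
      Fintype.card n * δ := by
    intro i
    refine Real.sqrt_le_iff.mpr ⟨by positivity, ?_⟩
    refine (Finset.single_le_sum (fun k _ => hnn k) (Finset.mem_univ i)).trans ?_
    rw [sum_eigenvalues_conjTranspose_mul_self]
    calc ∑ i, ∑ j, ‖A j i‖ ^ 2 ≤ ∑ _i : n, ∑ _j : n, δ ^ 2 := by
          gcongr with i _ j _
          exact h j i
      _ = _ := by simp; ring
  calc traceNorm A ≤ ∑ _i : n, Fintype.card n * δ := Finset.sum_le_sum fun i _ => h1 i
    _ = _ := by simp; ring

end TraceNorm

/-! ### Tensor products on the environment -/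

namespace Environment

variable (E : Environment)

theorem tensor_mul (A B : ∀ i, Matrix (Fin (E.dim i)) (Fin (E.dim i)) ℂ) :
    E.tensor (fun i => A i * B i) = E.tensor A * E.tensor B := by
  ext x y
  simp only [tensor, of_apply, mul_apply, ← Finset.prod_mul_distrib]
  rw [Finset.prod_univ_sum, Fintype.piFinset_univ]

theorem tensor_one : E.tensor (fun _ => 1) = 1 := by
  ext x y
  simp only [tensor, of_apply, one_apply, Finset.prod_ite_zero, Finset.prod_const_one,
    Finset.mem_univ, true_implies, funext_iff]

theorem tensor_posSemidef {A : ∀ i, Matrix (Fin (E.dim i)) (Fin (E.dim i)) ℂ}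
    (hA : ∀ i, (A i).PosSemidef) : (E.tensor A).PosSemidef :=
  PosSemidef.prod_apply hA

theorem trace_tensor (A : ∀ i, Matrix (Fin (E.dim i)) (Fin (E.dim i)) ℂ) :
    (E.tensor A).trace = ∏ i, (A i).trace := by
  simp only [trace, diag_apply, tensor, of_apply]
  rw [Finset.prod_univ_sum, Fintype.piFinset_univ]

end Environment

/-! ### Positivity of Gibbs states -/

section Gibbs

variable {n : Type*} [Fintype n] [DecidableEq n]

theorem posDef_exp {A : Matrix n n ℂ} (hA : A.IsHermitian) : (NormedSpace.exp A).PosDef := by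
  have h : NormedSpace.exp A = (NormedSpace.exp ((2⁻¹ : ℝ) • A))ᴴ * NormedSpace.exp ((2⁻¹ : ℝ) • A) := by
    have h1 : ((2⁻¹ : ℝ) • A).IsHermitian := by
      rw [IsHermitian, conjTranspose_smul, hA.eq]; simp
    rw [h1.exp.eq, ← Matrix.exp_add_of_commute _ _ (Commute.refl _), ← add_smul]
    norm_num
  rw [h]
  exact PosDef.conjTranspose_mul_self _ (mulVec_injective_of_isUnit (Matrix.isUnit_exp _))

theorem isHermitian_neg_smul {H : Matrix n n ℂ} (hH : H.IsHermitian) (β : ℝ) :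
    ((-β : ℂ) • H).IsHermitian := by
  rw [IsHermitian, conjTranspose_smul, hH.eq]; simp

theorem gibbs_posDef [Nonempty n] {H : Matrix n n ℂ} (hH : H.IsHermitian) (β : ℝ) :
    (gibbs β H).PosDef := by
  have h := posDef_exp (isHermitian_neg_smul hH β)
  exact h.smul (inv_pos.mpr h.trace_pos)

theorem isDensity_gibbs [Nonempty n] {H : Matrix n n ℂ} (hH : H.IsHermitian) (β : ℝ) :
    IsDensity (gibbs β H) := by
  refine ⟨(gibbs_posDef hH β).posSemidef, ?_⟩
  have h := (posDef_exp (isHermitian_neg_smul hH β)).trace_pos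
  rw [gibbs, trace_smul, smul_eq_mul, inv_mul_cancel₀ h.ne']

end Gibbs

end ExactEnergy

/-! ### Exponentials of sums over tensor factors, and invariance of Gibbs states -/

namespace Matrix

theorem exp_map_ringHom {m k : Type*} [Fintype m] [DecidableEq m] [Fintype k] [DecidableEq k]
    (f : Matrix m m ℂ →+* Matrix k k ℂ) (hf : Continuous f) (A : Matrix m m ℂ) :
    f (NormedSpace.exp A) = NormedSpace.exp (f A) := by
  let _ : NormedRing (Matrix m m ℂ) := Matrix.linftyOpNormedRing
  let _ : NormedAlgebra ℚ (Matrix m m ℂ) := Matrix.linftyOpNormedAlgebra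
  let _ : NormedRing (Matrix k k ℂ) := Matrix.linftyOpNormedRing
  let _ : NormedAlgebra ℚ (Matrix k k ℂ) := Matrix.linftyOpNormedAlgebra
  have hcomplete : CompleteSpace (Matrix m m ℂ) := inferInstanceAs (CompleteSpace (m → m → ℂ))
  exact @NormedSpace.map_exp _ _ _ _ hcomplete _ _ _ _ _ f hf A

theorem exp_kronecker_one {m k : Type*} [Fintype m] [DecidableEq m] [Fintype k] [DecidableEq k]
    (A : Matrix m m ℂ) : NormedSpace.exp (A ⊗ₖ (1 : Matrix k k ℂ)) = NormedSpace.exp A ⊗ₖ 1 := by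
  let f : Matrix m m ℂ →+* Matrix (m × k) (m × k) ℂ :=
    { toFun := fun A => A ⊗ₖ 1
      map_one' := one_kronecker_one
      map_mul' := fun A B => by rw [← mul_kronecker_mul, one_mul]
      map_zero' := zero_kronecker _
      map_add' := fun A B => add_kronecker _ _ _ }
  refine (exp_map_ringHom f ?_ A).symm
  refine continuous_matrix fun i j => ?_
  simp only [f, RingHom.coe_mk, MonoidHom.coe_mk, OneHom.coe_mk, kroneckerMap_apply]
  fun_prop

theorem exp_one_kronecker {m k : Type*} [Fintype m] [DecidableEq m] [Fintype k] [DecidableEq k]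
    (A : Matrix k k ℂ) : NormedSpace.exp ((1 : Matrix m m ℂ) ⊗ₖ A) = 1 ⊗ₖ NormedSpace.exp A := by
  let f : Matrix k k ℂ →+* Matrix (m × k) (m × k) ℂ :=
    { toFun := fun A => 1 ⊗ₖ A
      map_one' := one_kronecker_one
      map_mul' := fun A B => by rw [← mul_kronecker_mul, one_mul]
      map_zero' := kronecker_zero _
      map_add' := fun A B => kronecker_add _ _ _ }
  refine (exp_map_ringHom f ?_ A).symm
  refine continuous_matrix fun i j => ?_
  simp only [f, RingHom.coe_mk, MonoidHom.coe_mk, OneHom.coe_mk, kroneckerMap_apply]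
  fun_prop

end Matrix

namespace ExactEnergy

namespace Environment

variable (E : Environment)

theorem tensor_update_apply (i : Fin E.N) (A : Matrix (Fin (E.dim i)) (Fin (E.dim i)) ℂ)
    (x y : E.Idx) :
    E.tensor (Function.update (fun _ => 1) i A) x y =
      A (x i) (y i) * ∏ j ∈ Finset.univ.erase i, (1 : Matrix (Fin (E.dim j)) _ ℂ) (x j) (y j) := by
  rw [tensor, of_apply, ← Finset.mul_prod_erase _ _ (Finset.mem_univ i), Function.update_self]
  congr 1
  refine Finset.prod_congr rfl fun j hj => ?_
  rw [Function.update_of_ne (Finset.ne_of_mem_erase hj)]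

/-- The embedding of the operators on the `i`-th system into those on the environment. -/
def embed (i : Fin E.N) : Matrix (Fin (E.dim i)) (Fin (E.dim i)) ℂ →+* Matrix E.Idx E.Idx ℂ where
  toFun A := E.tensor (Function.update (fun _ => 1) i A)
  map_one' := by
    rw [Function.update_eq_self_iff.mpr rfl, tensor_one]
  map_mul' A B := by
    rw [← tensor_mul]
    congr 1
    funext j
    by_cases h : j = i
    · subst h; simp
    · simp [Function.update_of_ne h]
  map_zero' := by
    ext x y; simp [tensor_update_apply]
  map_add' A B := by
    ext x y; simp [tensor_update_apply, add_mul]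

theorem embed_apply (i : Fin E.N) (A : Matrix (Fin (E.dim i)) (Fin (E.dim i)) ℂ) :
    E.embed i A = E.tensor (Function.update (fun _ => 1) i A) := rfl

theorem exp_embed (i : Fin E.N) (A : Matrix (Fin (E.dim i)) (Fin (E.dim i)) ℂ) :
    NormedSpace.exp (E.embed i A) = E.embed i (NormedSpace.exp A) := by
  refine (exp_map_ringHom (E.embed i) ?_ A).symm
  refine continuous_matrix fun x y => ?_
  simp only [embed_apply, tensor_update_apply]
  fun_prop

theorem exp_sum_embed (A : ∀ i, Matrix (Fin (E.dim i)) (Fin (E.dim i)) ℂ)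
    (s : Finset (Fin E.N)) :
    NormedSpace.exp (∑ i ∈ s, E.embed i (A i)) =
      E.tensor fun i => if i ∈ s then NormedSpace.exp (A i) else 1 := by
  induction s using Finset.induction_on with
  | empty => simp [tensor_one]
  | insert a s ha ih =>
    have hcomm : Commute (E.embed a (A a)) (∑ i ∈ s, E.embed i (A i)) := by
      refine Commute.sum_right _ _ _ fun i hi => ?_
      have hne : i ≠ a := fun h => ha (h ▸ hi)
      rw [Commute, SemiconjBy, embed_apply, embed_apply, ← tensor_mul, ← tensor_mul]
      congr 1
      funext j
      by_cases h : j = a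
      · subst h; simp [Function.update_of_ne hne.symm]
      · simp [Function.update_of_ne h]
    rw [Finset.sum_insert ha, Matrix.exp_add_of_commute _ _ hcomm, ih, exp_embed, embed_apply,
      ← tensor_mul]
    congr 1
    funext j
    by_cases h : j = a
    · subst h; simp [ha]
    · simp [h]

theorem smul_hamiltonian (c : ℂ) :
    c • E.hamiltonian = ∑ i, E.embed i (c • E.ham i) := by
  rw [hamiltonian, Finset.smul_sum]
  refine Finset.sum_congr rfl fun i _ => ?_
  ext x y
  simp [embed_apply, tensor_update_apply, mul_assoc]

theorem exp_smul_hamiltonian (c : ℂ) :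
    NormedSpace.exp (c • E.hamiltonian) = E.tensor fun i => NormedSpace.exp (c • E.ham i) := by
  rw [smul_hamiltonian, exp_sum_embed]
  simp

theorem exp_smul_totalHamiltonian {n : Type*} [Fintype n] [DecidableEq n] (H : Matrix n n ℂ)
    (c : ℂ) : NormedSpace.exp (c • E.totalHamiltonian H) =
      NormedSpace.exp (c • H) ⊗ₖ E.tensor fun i => NormedSpace.exp (c • E.ham i) := by
  have hcomm : Commute ((c • H) ⊗ₖ (1 : Matrix E.Idx E.Idx ℂ))
      ((1 : Matrix n n ℂ) ⊗ₖ (c • E.hamiltonian)) := by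
    rw [Commute, SemiconjBy, ← mul_kronecker_mul, ← mul_kronecker_mul]
    simp
  rw [totalHamiltonian, smul_add, ← smul_kronecker, ← kronecker_smul,
    Matrix.exp_add_of_commute _ _ hcomm, exp_kronecker_one, exp_one_kronecker,
    ← mul_kronecker_mul, one_mul, mul_one, exp_smul_hamiltonian]

theorem tensor_smul (c : Fin E.N → ℂ) (A : ∀ i, Matrix (Fin (E.dim i)) (Fin (E.dim i)) ℂ) :
    E.tensor (fun i => c i • A i) = (∏ i, c i) • E.tensor A := by
  ext x y
  simp [tensor, Finset.prod_mul_distrib]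

/-- Being a function of the total Hamiltonian, the joint thermal state commutes with every
energy-conserving unitary. -/
theorem gibbs_kronecker_tensor_gibbs {n : Type*} [Fintype n] [DecidableEq n] (H : Matrix n n ℂ)
    (β : ℝ) : ∃ c : ℂ, gibbs β H ⊗ₖ E.tensor (fun i => gibbs β (E.ham i)) =
      c • NormedSpace.exp ((-β : ℂ) • E.totalHamiltonian H) := by
  refine ⟨(NormedSpace.exp ((-β : ℂ) • H)).trace⁻¹ *
    ∏ i, (NormedSpace.exp ((-β : ℂ) • E.ham i)).trace⁻¹, ?_⟩
  simp only [gibbs]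
  rw [tensor_smul, exp_smul_totalHamiltonian, smul_kronecker, kronecker_smul, smul_smul]

theorem isDensity_gibbs_ham (β : ℝ) (i : Fin E.N) : IsDensity (gibbs β (E.ham i)) :=
  haveI : Nonempty (Fin (E.dim i)) := ⟨⟨0, E.dim_pos i⟩⟩
  isDensity_gibbs (E.ham_herm i) β

theorem gibbs_ham_mem_macrostate (β : ℝ) (i : Fin E.N) :
    gibbs β (E.ham i) ∈ macrostate (thermalEnergy β (E.ham i)) (E.ham i) :=
  ⟨E.isDensity_gibbs_ham β i, rfl⟩

theorem evolve_of_commute {n : Type*} [Fintype n] [DecidableEq n]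
    {U : Matrix (n × E.Idx) (n × E.Idx) ℂ} (hU : U ∈ unitaryGroup (n × E.Idx) ℂ)
    {ρ : Matrix n n ℂ} {ρE : ∀ i, Matrix (Fin (E.dim i)) (Fin (E.dim i)) ℂ}
    (htr : ∀ i, (ρE i).trace = 1) (h : Commute U (ρ ⊗ₖ E.tensor ρE)) :
    E.evolve U ρ ρE = ρ := by
  rw [evolve, h.eq, mul_assoc, show U * Uᴴ = 1 from mem_unitaryGroup_iff.mp hU, mul_one]
  ext i j
  have := E.trace_tensor ρE
  rw [Finset.prod_eq_one fun i _ => htr i] at this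
  simp only [trace, diag_apply] at this
  simp [partialTrace, kroneckerMap_apply, ← Finset.mul_sum, this]

/-- Energy-conserving unitaries with a thermal environment preserve the Gibbs state. -/
theorem evolve_gibbs {n : Type*} [Fintype n] [DecidableEq n] {H : Matrix n n ℂ} {β : ℝ}
    {U : Matrix (n × E.Idx) (n × E.Idx) ℂ} (hU : U ∈ unitaryGroup (n × E.Idx) ℂ)
    (hc : Commute U (E.totalHamiltonian H)) :
    E.evolve U (gibbs β H) (fun i => gibbs β (E.ham i)) = gibbs β H := by
  refine E.evolve_of_commute hU (fun i => (E.isDensity_gibbs_ham β i).2) ?_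
  obtain ⟨c, h⟩ := E.gibbs_kronecker_tensor_gibbs H β
  rw [h]
  exact ((hc.smul_right _).exp_right).smul_right _

section Linear

variable {n : Type*} [Fintype n] (U : Matrix (n × E.Idx) (n × E.Idx) ℂ)
  (ρE : ∀ i, Matrix (Fin (E.dim i)) (Fin (E.dim i)) ℂ)

theorem evolve_add (ρ σ : Matrix n n ℂ) :
    E.evolve U (ρ + σ) ρE = E.evolve U ρ ρE + E.evolve U σ ρE := by
  ext i j
  simp [evolve, partialTrace, add_kronecker, mul_add, add_mul, Finset.sum_add_distrib]

theorem evolve_smul (c : ℂ) (ρ : Matrix n n ℂ) :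
    E.evolve U (c • ρ) ρE = c • E.evolve U ρ ρE := by
  ext i j
  simp [evolve, partialTrace, smul_kronecker, Finset.mul_sum]

theorem re_evolve_diag_nonneg {ρ : Matrix n n ℂ} (hρ : ρ.PosSemidef)
    (hE : ∀ i, (ρE i).PosSemidef) (i : n) : 0 ≤ (E.evolve U ρ ρE i i).re := by
  have h := (hρ.kronecker (E.tensor_posSemidef hE)).mul_mul_conjTranspose_same U
  simp only [evolve, partialTrace, of_apply, Complex.re_sum]
  exact Finset.sum_nonneg fun k _ => h.re_diag_nonneg _

end Linear

end Environment

end ExactEnergy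

namespace ExactEnergy

/-! ### The inequality for classical distributions -/

section Classical

variable {n : Type*} [Fintype n]

/-- Suppose that positive linear maps fixing `γ` send all distributions of mean energy `e` above the
mean energy of `γ` arbitrarily close to `r`. If there are three energy levels, the mean energy of
`r` is below `e`. -/
theorem sum_mul_lt_of_positive_maps [DecidableEq n] {E γ σ r : n → ℝ} {e : ℝ} {lo mid hi : n}
    (hlo : ∀ j, E lo ≤ E j) (hhi : ∀ j, E j ≤ E hi) (hlm : E lo < E mid) (hmh : E mid < E hi)
    (hγ : ∀ j, 0 < γ j) (hγ1 : ∑ j, γ j = 1) (hσ : ∀ j, 0 < σ j) (hσ1 : ∑ j, σ j = 1)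
    (hσe : ∑ j, σ j * E j = e) (he : ∑ j, γ j * E j < e) (hr1 : ∑ j, r j = 1)
    (hΦ : ∀ ε : ℝ, 0 < ε → ∃ Φ : (n → ℝ) →ₗ[ℝ] (n → ℝ), (∀ p, (∀ j, 0 ≤ p j) → ∀ j, 0 ≤ Φ p j) ∧
      Φ γ = γ ∧ ∀ p, (∀ j, 0 ≤ p j) → ∑ j, p j = 1 → ∑ j, p j * E j = e →
        ∀ j, |r j - Φ p j| ≤ ε) :
    ∑ j, r j * E j < e := by
  set g := ∑ j, γ j * E j with hg
  have hsub : ∀ (p : n → ℝ) (c : ℝ), ∑ j, p j = 1 → ∑ j, p j * (c - E j) = c - ∑ j, p j * E j := by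
    intro p c hp
    simp only [mul_sub, Finset.sum_sub_distrib, ← Finset.sum_mul, hp, one_mul]
  have hglo : E lo < g := by
    have : 0 < ∑ j, γ j * (E j - E lo) :=
      Finset.sum_pos' (fun j _ => mul_nonneg (hγ j).le (sub_nonneg.mpr (hlo j)))
        ⟨mid, Finset.mem_univ _, mul_pos (hγ mid) (sub_pos.mpr hlm)⟩
    have h2 := hsub γ (E lo) hγ1
    have h3 : ∑ j, γ j * (E j - E lo) = - ∑ j, γ j * (E lo - E j) := by
      rw [← Finset.sum_neg_distrib]; exact Finset.sum_congr rfl fun j _ => by ring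
    linarith
  have hehi : e < E hi := by
    have : 0 < ∑ j, σ j * (E hi - E j) :=
      Finset.sum_pos' (fun j _ => mul_nonneg (hσ j).le (sub_nonneg.mpr (hhi j)))
        ⟨mid, Finset.mem_univ _, mul_pos (hσ mid) (sub_pos.mpr hmh)⟩
    linarith [hsub σ (E hi) hσ1]
  -- `δ` keeps `σ - δ γ` nonnegative; the minimum of `σ` serves, since `γ ≤ 1`.
  obtain ⟨δ, hδ0, hδ1, hδ⟩ : ∃ δ : ℝ, 0 < δ ∧ δ ≤ 1 ∧ ∀ j, δ * γ j ≤ σ j := by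
    have hne : (Finset.univ : Finset n).Nonempty := ⟨lo, Finset.mem_univ _⟩
    obtain ⟨k, -, hk⟩ := Finset.exists_min_image Finset.univ σ hne
    have hle : ∀ (p : n → ℝ), (∀ j, 0 < p j) → ∑ j, p j = 1 → ∀ j, p j ≤ 1 := fun p hp h1 j =>
      (Finset.single_le_sum (fun i _ => (hp i).le) (Finset.mem_univ j)).trans h1.le
    refine ⟨σ k, hσ k, hle σ hσ hσ1 k, fun j => ?_⟩
    nlinarith [hk j (Finset.mem_univ j), hle γ hγ hγ1 j, hσ k]
  -- Mixing weights: `(1 - t) g + t E_hi = e` and `(1 - l) e + l E_lo = g`.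
  set t := (e - g) / (E hi - g) with ht
  set l := (e - g) / (e - E lo) with hl
  have ht0 : 0 < t := div_pos (by linarith) (by linarith)
  have ht1 : t < 1 := (div_lt_one (by linarith)).mpr (by linarith)
  have hl0 : 0 < l := div_pos (by linarith) (by linarith)
  have hl1 : l < 1 := (div_lt_one (by linarith)).mpr (by linarith)
  have hte : t * (E hi - g) = e - g := div_mul_cancel₀ _ (by linarith)
  have hle : l * (e - E lo) = e - g := div_mul_cancel₀ _ (by linarith)
  have hs1 : ∀ k : n, ∑ j, (Pi.single k 1 : n → ℝ) j = 1 := fun k => by simp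
  have hsE : ∀ k : n, ∑ j, (Pi.single k 1 : n → ℝ) j * E j = E k := fun k => by
    simp [Pi.single_apply]
  have hs0 : ∀ k j : n, 0 ≤ (Pi.single k 1 : n → ℝ) j := fun k j => by
    rw [Pi.single_apply]; split_ifs <;> norm_num
  have hlower : ∀ j, (1 - t) * γ j ≤ r j := by
    intro j
    refine le_of_forall_pos_le_add fun ε hε => ?_
    obtain ⟨Φ, hpos, hfix, happ⟩ := hΦ ε hε
    have h := happ ((1 - t) • γ + t • Pi.single hi 1) ?_ ?_ ?_ j
    · rw [map_add, map_smul, map_smul, hfix] at h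
      have h2 := mul_nonneg ht0.le (hpos _ (hs0 hi) j)
      simp only [Pi.add_apply, Pi.smul_apply, smul_eq_mul] at h
      linarith [(abs_le.mp h).1]
    · intro k
      simp only [Pi.add_apply, Pi.smul_apply, smul_eq_mul]
      have := mul_nonneg ht0.le (hs0 hi k)
      have := mul_nonneg (sub_nonneg.mpr ht1.le) (hγ k).le
      linarith
    · simp only [Pi.add_apply, Pi.smul_apply, smul_eq_mul, Finset.sum_add_distrib,
        ← Finset.mul_sum, hγ1, hs1]
      ring
    · simp only [Pi.add_apply, Pi.smul_apply, smul_eq_mul, Finset.sum_add_distrib, add_mul,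
        mul_assoc, ← Finset.mul_sum, hsE, ← hg]
      linarith
  have hupper : ∀ j, (1 - l) * r j ≤ γ j := by
    -- A distribution of energy `g` cannot be fed to the approximation hypothesis. Instead a portion
    -- `δ γ` of `σ` is replaced by `δ (l 1_lo + (1 - l) σ)`, which has the same mass and energy.
    intro j
    refine le_of_forall_pos_le_add fun ε hε => ?_
    -- Three errors of this size add up to `δ ε`, and the final inequality is divided by `δ`.
    obtain ⟨Φ, hpos, hfix, happ⟩ := hΦ (δ * ε / 3) (by positivity)
    have h0 := happ σ (fun k => (hσ k).le) hσ1 hσe j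
    have h := happ (σ - δ • γ + δ • (l • Pi.single lo 1 + (1 - l) • σ)) ?_ ?_ ?_ j
    · rw [map_add, map_sub, map_smul, map_smul, map_add, map_smul, map_smul, hfix] at h
      have h2 := mul_nonneg hδ0.le (mul_nonneg hl0.le (hpos _ (hs0 lo) j))
      simp only [Pi.add_apply, Pi.sub_apply, Pi.smul_apply, smul_eq_mul] at h
      have h3 := abs_le.mp h
      have h4 := abs_le.mp h0
      have h5 : δ * ((1 - l) * (r j - Φ σ j)) ≤ δ * ε / 3 := by
        have : δ * (1 - l) ≤ 1 := by nlinarith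
        have h6 : 0 ≤ δ * (1 - l) := mul_nonneg hδ0.le (by linarith)
        nlinarith [mul_le_mul_of_nonneg_left h4.2 h6, mul_pos hδ0 hε]
      have h7 : δ * ((1 - l) * r j) ≤ δ * (γ j + ε) := by linarith
      exact le_of_mul_le_mul_left h7 hδ0
    · intro k
      simp only [Pi.add_apply, Pi.sub_apply, Pi.smul_apply, smul_eq_mul]
      have := mul_nonneg hδ0.le (add_nonneg (mul_nonneg hl0.le (hs0 lo k))
        (mul_nonneg (sub_nonneg.mpr hl1.le) (hσ k).le))
      linarith [hδ k]
    · simp only [Pi.add_apply, Pi.sub_apply, Pi.smul_apply, smul_eq_mul, Finset.sum_add_distrib,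
        Finset.sum_sub_distrib, ← Finset.mul_sum, hγ1, hs1, hσ1]
      ring
    · simp only [Pi.add_apply, Pi.sub_apply, Pi.smul_apply, smul_eq_mul, Finset.sum_add_distrib,
        Finset.sum_sub_distrib, add_mul, sub_mul, mul_assoc, ← Finset.mul_sum, hsE, ← hg, hσe]
      linear_combination (-δ) * hle
  by_contra hcon
  rw [not_lt] at hcon
  -- The sum equals `e` minus the energy of `r`. Its terms are nonnegative, so each of them
  -- vanishes; the next sum is treated alike.
  have hzero1 : ∑ j, (r j - (1 - t) * γ j) * (E hi - E j) ≤ 0 := by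
    have : ∑ j, (r j - (1 - t) * γ j) * (E hi - E j) =
        ∑ j, r j * (E hi - E j) - (1 - t) * ∑ j, γ j * (E hi - E j) := by
      rw [Finset.mul_sum, ← Finset.sum_sub_distrib]
      exact Finset.sum_congr rfl fun j _ => by ring
    rw [this, hsub r _ hr1, hsub γ _ hγ1, ← hg]
    linarith
  have hzero2 : ∑ j, (γ j - (1 - l) * r j) * (E j - E lo) ≤ 0 := by
    have : ∑ j, (γ j - (1 - l) * r j) * (E j - E lo) =
        (1 - l) * ∑ j, r j * (E lo - E j) - ∑ j, γ j * (E lo - E j) := by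
      rw [Finset.mul_sum, ← Finset.sum_sub_distrib]
      exact Finset.sum_congr rfl fun j _ => by ring
    rw [this, hsub r _ hr1, hsub γ _ hγ1, ← hg]
    nlinarith
  have hm1 : (r mid - (1 - t) * γ mid) * (E hi - E mid) ≤ 0 :=
    (Finset.single_le_sum (f := fun j => (r j - (1 - t) * γ j) * (E hi - E j))
      (fun j _ => mul_nonneg (sub_nonneg.mpr (hlower j)) (sub_nonneg.mpr (hhi j)))
      (Finset.mem_univ mid)).trans hzero1
  have hm2 : (γ mid - (1 - l) * r mid) * (E mid - E lo) ≤ 0 :=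
    (Finset.single_le_sum (f := fun j => (γ j - (1 - l) * r j) * (E j - E lo))
      (fun j _ => mul_nonneg (sub_nonneg.mpr (hupper j)) (sub_nonneg.mpr (hlo j)))
      (Finset.mem_univ mid)).trans hzero2
  have h1 : r mid ≤ (1 - t) * γ mid := by nlinarith
  have h2 : γ mid ≤ (1 - l) * r mid := by nlinarith
  -- Together, `γ_mid ≤ (1 - l)(1 - t) γ_mid` with `γ_mid > 0`.
  nlinarith [hγ mid, mul_pos ht0 (hγ mid), mul_pos hl0 (hγ mid), mul_le_mul_of_nonneg_left h1 (sub_pos.mpr hl1).le]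

/-- The Gibbs distribution of a family of energy levels. -/
noncomputable def boltzmann (β : ℝ) (E : n → ℝ) (i : n) : ℝ := Real.exp (-β * E i) / ∑ j, Real.exp (-β * E j)

theorem boltzmann_pos (β : ℝ) (E : n → ℝ) (i : n) : 0 < boltzmann β E i :=
  div_pos (Real.exp_pos _) (Finset.sum_pos (fun _ _ => Real.exp_pos _) ⟨i, Finset.mem_univ i⟩)

theorem sum_boltzmann [Nonempty n] (β : ℝ) (E : n → ℝ) : ∑ i, boltzmann β E i = 1 := by
  have : 0 < ∑ j, Real.exp (-β * E j) :=
    Finset.sum_pos (fun _ _ => Real.exp_pos _) Finset.univ_nonempty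
  simp only [boltzmann, ← Finset.sum_div, div_self this.ne']

/-- The mean energy of a Gibbs distribution is strictly decreasing in the inverse temperature. -/
theorem sum_boltzmann_mul_lt {E : n → ℝ} {β b : ℝ} (hb : b < β) {i j : n} (hij : E i < E j) :
    ∑ k, boltzmann β E k * E k < ∑ k, boltzmann b E k * E k := by
  have : Nonempty n := ⟨i⟩
  -- Chebyshev's symmetrization: lowering the inverse temperature raises the relative weight of the
  -- higher of two levels, so both factors have the same sign. The double sum is twice the energy
  -- difference.
  have key : 0 < ∑ k, ∑ l, (boltzmann b E k * boltzmann β E l - boltzmann b E l * boltzmann β E k) *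
      (E k - E l) := by
    have hle : ∀ k l, E l < E k → 0 < (boltzmann b E k * boltzmann β E l -
        boltzmann b E l * boltzmann β E k) * (E k - E l) := by
      intro k l hkl
      refine mul_pos (sub_pos.mpr ?_) (sub_pos.mpr hkl)
      have hZ : ∀ c : ℝ, 0 < ∑ j, Real.exp (-c * E j) := fun c =>
        Finset.sum_pos (fun _ _ => Real.exp_pos _) Finset.univ_nonempty
      simp only [boltzmann, div_mul_div_comm, ← Real.exp_add]
      refine div_lt_div_of_pos_right (Real.exp_lt_exp.mpr ?_) (mul_pos (hZ _) (hZ _))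
      nlinarith
    have hnn : ∀ k l, 0 ≤ (boltzmann b E k * boltzmann β E l -
        boltzmann b E l * boltzmann β E k) * (E k - E l) := by
      intro k l
      rcases lt_trichotomy (E l) (E k) with h | h | h
      · exact (hle k l h).le
      · rw [h, sub_self, mul_zero]
      · have := (hle l k h).le
        linarith
    refine Finset.sum_pos' (fun k _ => Finset.sum_nonneg fun l _ => hnn k l)
      ⟨j, Finset.mem_univ _, Finset.sum_pos' (fun l _ => hnn j l) ⟨i, Finset.mem_univ _, hle j i hij⟩⟩
  have hexp : ∑ k, ∑ l, (boltzmann b E k * boltzmann β E l - boltzmann b E l * boltzmann β E k) *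
      (E k - E l) = 2 * (∑ k, boltzmann b E k * E k - ∑ k, boltzmann β E k * E k) := by
    have e1 : ∀ k l, (boltzmann b E k * boltzmann β E l - boltzmann b E l * boltzmann β E k) *
      (E k - E l) = (boltzmann b E k * E k) * boltzmann β E l +
        boltzmann β E k * (boltzmann b E l * E l) - (boltzmann β E k * E k) * boltzmann b E l
        - boltzmann b E k * (boltzmann β E l * E l) := fun k l => by ring
    simp only [e1, Finset.sum_sub_distrib, Finset.sum_add_distrib, ← Finset.mul_sum,
      ← Finset.sum_mul, sum_boltzmann]
    ring
  linarith

theorem IsDensity.sum_re_diag {ρ : Matrix n n ℂ} (h : IsDensity ρ) : ∑ i, (ρ i i).re = 1 := by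
  have := congrArg Complex.re h.2
  simpa [trace, Complex.re_sum] using this

end Classical

/-! ### Diagonal Hamiltonians and the bound for macrostate operations -/

section Diagonal

variable {n : Type*} [DecidableEq n]

/-- The Hamiltonian that is diagonal with the given energy levels. -/
def diagHam (E : n → ℝ) : Matrix n n ℂ := diagonal fun i => (E i : ℂ)

theorem diagHam_isHermitian (E : n → ℝ) : (diagHam E).IsHermitian := by
  rw [diagHam, IsHermitian, diagonal_conjTranspose]
  congr 1
  funext i
  simp

variable [Fintype n]

theorem gibbs_diagHam (β : ℝ) (E : n → ℝ) : gibbs β (diagHam E) = diagHam (boltzmann β E) := by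
  have h : (-β : ℂ) • diagHam E = diagonal fun i => (((-β * E i : ℝ)) : ℂ) := by
    rw [diagHam, ← diagonal_smul]
    congr 1
    funext i
    simp
  have h2 : NormedSpace.exp ((-β : ℂ) • diagHam E) = diagHam fun i => Real.exp (-β * E i) := by
    rw [h, exp_diagonal, diagHam]
    congr 1
    funext i
    rw [Pi.coe_exp, ← Complex.exp_eq_exp_ℂ, ← Complex.ofReal_exp]
  rw [gibbs, h2]
  simp only [diagHam, trace_diagonal]
  rw [← diagonal_smul]
  congr 1
  funext i
  simp [boltzmann, div_eq_inv_mul]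

theorem meanEnergy_diagHam (E : n → ℝ) (ρ : Matrix n n ℂ) :
    meanEnergy (diagHam E) ρ = ∑ i, (ρ i i).re * E i := by
  simp [meanEnergy, diagHam, trace, Complex.re_sum]

theorem isDensity_diagHam {p : n → ℝ} (h0 : ∀ i, 0 ≤ p i) (h1 : ∑ i, p i = 1) :
    IsDensity (diagHam p) := by
  refine ⟨PosSemidef.diagonal fun i => ?_, ?_⟩
  · simpa using h0 i
  · rw [diagHam, trace_diagonal, ← Complex.ofReal_sum, h1, Complex.ofReal_one]

theorem diagHam_mem_macrostate {E p : n → ℝ} {e : ℝ} (h0 : ∀ i, 0 ≤ p i) (h1 : ∑ i, p i = 1)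
    (he : ∑ i, p i * E i = e) : diagHam p ∈ macrostate e (diagHam E) := by
  refine ⟨isDensity_diagHam h0 h1, ?_⟩
  rw [meanEnergy_diagHam, ← he]
  simp [diagHam]

/-- Reduction to the classical inequality: `Φ` embeds a distribution as a diagonal matrix, evolves
it with the environment in its Gibbs states and reads off the diagonal. -/
theorem CommutingMacro.meanEnergy_lt {E : n → ℝ} {β e : ℝ} {lo mid hi : n}
    (hlo : ∀ j, E lo ≤ E j) (hhi : ∀ j, E j ≤ E hi) (hlm : E lo < E mid) (hmh : E mid < E hi)
    {σ : n → ℝ} (hσ : ∀ j, 0 < σ j) (hσ1 : ∑ j, σ j = 1)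
    (hσe : ∑ j, σ j * E j = e) (he : ∑ j, boltzmann β E j * E j < e)
    {ρf : Matrix n n ℂ} (h : CommutingMacro β e (diagHam E) ρf) :
    meanEnergy (diagHam E) ρf < e := by
  have : Nonempty n := ⟨lo⟩
  rw [meanEnergy_diagHam]
  refine sum_mul_lt_of_positive_maps (r := fun i => (ρf i i).re) hlo hhi hlm hmh
    (boltzmann_pos β E) (sum_boltzmann β E) hσ hσ1 hσe he h.1.sum_re_diag fun ε hε => ?_
  obtain ⟨Env, U, hU, hc, happ⟩ := h.2 ε hε
  set gE := fun i => gibbs β (Env.ham i)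
  have hadd : ∀ p q : n → ℝ, diagHam (p + q) = diagHam p + diagHam q := fun p q => by
    simp [diagHam, diagonal_add]
  have hsmul : ∀ (c : ℝ) (p : n → ℝ), diagHam (c • p) = (c : ℂ) • diagHam p := fun c p => by
    rw [diagHam, diagHam, ← diagonal_smul]; congr 1; funext i; simp
  refine ⟨{ toFun := fun p j => (Env.evolve U (diagHam p) gE j j).re
            map_add' := ?_
            map_smul' := ?_ }, ?_, ?_, ?_⟩
  · intro p q
    funext j
    simp [hadd, Env.evolve_add]
  · intro c p
    funext j
    simp only [hsmul, Env.evolve_smul]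
    simp
  · intro p hp j
    refine Env.re_evolve_diag_nonneg U gE (PosSemidef.diagonal fun i => ?_)
      (fun i => (Env.isDensity_gibbs_ham β i).1) j
    simpa using hp i
  · funext j
    simp only [LinearMap.coe_mk, AddHom.coe_mk]
    rw [← gibbs_diagHam, Env.evolve_gibbs hU hc, gibbs_diagHam]
    simp [diagHam]
  · intro p hp0 hp1 hpe j
    have h1 := happ _ (diagHam_mem_macrostate hp0 hp1 hpe) gE (Env.gibbs_ham_mem_macrostate β)
    have h2 := (norm_apply_le_traceNorm _ j j).trans h1
    refine le_trans ?_ h2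
    rw [Matrix.sub_apply]
    refine le_trans (le_of_eq ?_) (Complex.abs_re_le_norm _)
    rw [Complex.sub_re]
    rfl

end Diagonal

end ExactEnergy

namespace ExactEnergy

/-! ### Swapping the system with an occupied register -/

section Swap

variable {n R W : Type*} [Fintype n] [DecidableEq n] [Fintype R] [DecidableEq R]
  [Fintype W] [DecidableEq W] (φ : n → W)

/-- The registers of `z` whose state lies in the range of `φ`. -/
def occupied (z : R → W) : Finset R := Finset.univ.filter fun r => ∃ k, φ k = z r

/-- Because the set of occupied registers survives the swap, a second swap selects the same
register; this makes `swapMap` an involution. -/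
theorem occupied_update {z : R → W} {r : R} (hr : r ∈ occupied φ z) (k : n) :
    occupied φ (Function.update z r (φ k)) = occupied φ z := by
  ext s
  by_cases hs : s = r
  · subst hs
    simpa [occupied] using hr
  · simp [occupied, Function.update_of_ne hs]

variable [Nonempty n] (sel : Finset R → R)

/-- Swap the state of a system with that of the selected occupied register, if there is any. -/
noncomputable def swapMap (a : n × (R → W)) : n × (R → W) :=
  if (occupied φ a.2).Nonempty then
    (Function.invFun φ (a.2 (sel (occupied φ a.2))),
      Function.update a.2 (sel (occupied φ a.2)) (φ a.1))
  else a

variable {φ sel}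

theorem swapMap_of_empty {k : n} {z : R → W} (h : ¬ (occupied φ z).Nonempty) :
    swapMap φ sel (k, z) = (k, z) := if_neg h

theorem swapMap_of_nonempty (hφ : Function.Injective φ) (k : n) {j : n} {z : R → W}
    (h : (occupied φ z).Nonempty) (hj : z (sel (occupied φ z)) = φ j) :
    swapMap φ sel (k, z) = (j, Function.update z (sel (occupied φ z)) (φ k)) := by
  rw [swapMap, if_pos h]
  simp only [hj, Function.leftInverse_invFun hφ j]

variable (hsel : ∀ s : Finset R, s.Nonempty → sel s ∈ s)
include hsel

theorem exists_apply_sel {z : R → W} (h : (occupied φ z).Nonempty) :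
    ∃ j, z (sel (occupied φ z)) = φ j := by
  have := hsel _ h
  simp only [occupied, Finset.mem_filter, Finset.mem_univ, true_and] at this
  obtain ⟨j, hj⟩ := this
  exact ⟨j, hj.symm⟩

theorem swapMap_involutive (hφ : Function.Injective φ) :
    Function.Involutive (swapMap (R := R) φ sel) := by
  rintro ⟨k, z⟩
  by_cases h : (occupied φ z).Nonempty
  · obtain ⟨j, hj⟩ := exists_apply_sel hsel h
    have hu := occupied_update φ (hsel _ h) k
    rw [swapMap_of_nonempty hφ k h hj, swapMap_of_nonempty hφ j (j := k) (by rwa [hu]) (by simp [hu]),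
      hu, Function.update_idem, ← hj, Function.update_eq_self]
  · rw [swapMap_of_empty h, swapMap_of_empty h]

variable {P : W → ℝ} {γ : n → ℝ} {c : ℝ}

/-- If the registers are distributed independently, each being thermal on the range of `φ`, then
the swap thermalizes the system up to the probability that no register is occupied. -/
theorem sum_swapMap (hφ : Function.Injective φ) (hP1 : ∑ w, P w = 1)
    (hPφ : ∀ k, P (φ k) = c * γ k) (hγ1 : ∑ k, γ k = 1) {p : n → ℝ} (hp : ∑ k, p k = 1) (k : n) :
    ∑ z : R → W, p (swapMap φ sel (k, z)).1 * ∏ r, P ((swapMap φ sel (k, z)).2 r) =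
      γ k + (1 - c) ^ Fintype.card R * (p k - γ k) := by
  classical
  have htot : ∑ z : R → W, ∏ r, P (z r) = 1 := by
    rw [← Fintype.piFinset_univ, ← Finset.prod_univ_sum (fun _ => Finset.univ) fun _ w => P w, hP1,
      Finset.prod_const_one]
  -- The weight `γ ⊗ P` is invariant under the swap because `P ∘ φ` is proportional to `γ`. Only the
  -- deviation `p - γ` then remains.
  have hγs : ∑ z : R → W, γ (swapMap φ sel (k, z)).1 * ∏ r, P ((swapMap φ sel (k, z)).2 r) =
      γ k := by
    rw [← mul_one (γ k), ← htot, Finset.mul_sum]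
    refine Finset.sum_congr rfl fun z _ => ?_
    by_cases h : (occupied φ z).Nonempty
    · obtain ⟨j, hj⟩ := exists_apply_sel hsel h
      rw [swapMap_of_nonempty hφ k h hj]
      dsimp only
      rw [← Finset.mul_prod_erase _ _ (Finset.mem_univ (sel (occupied φ z))),
        ← Finset.mul_prod_erase _ (fun r => P (z r)) (Finset.mem_univ (sel (occupied φ z))),
        Function.update_self, hPφ, hj, hPφ]
      rw [Finset.prod_congr rfl fun r hr => by
        rw [Function.update_of_ne (Finset.ne_of_mem_erase hr)]]
      ring
    · rw [swapMap_of_empty h]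
  have hnone : ∑ z : R → W with ¬ (occupied φ z).Nonempty, ∏ r, P (z r) =
      (1 - c) ^ Fintype.card R := by
    have h1 : (Finset.univ.filter fun z : R → W => ¬ (occupied φ z).Nonempty) =
        Fintype.piFinset fun _ => (Finset.univ.image φ)ᶜ := by
      ext z
      simp [occupied, Finset.not_nonempty_iff_eq_empty, Finset.filter_eq_empty_iff]
    have h2 : ∑ w ∈ (Finset.univ.image φ)ᶜ, P w = 1 - c := by
      have h3 := Finset.sum_compl_add_sum (Finset.univ.image φ) P
      rw [Finset.sum_image hφ.injOn, hP1] at h3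
      simp only [hPφ, ← Finset.mul_sum, hγ1] at h3
      linarith
    rw [h1, ← Finset.prod_univ_sum (fun _ => (Finset.univ.image φ)ᶜ) fun _ w => P w, h2,
      Finset.prod_const, Finset.card_univ]
  -- The total weight after the swap does not depend on the state `j` that was in the register. So
  -- the deviations `p j - γ j` enter with equal weights and cancel.
  have hocc : ∀ j, ∑ z : R → W with (occupied φ z).Nonempty ∧ z (sel (occupied φ z)) = φ j,
      ∏ r, P (Function.update z (sel (occupied φ z)) (φ k) r) =
      ∑ z : R → W with (occupied φ z).Nonempty ∧ z (sel (occupied φ z)) = φ k, ∏ r, P (z r) := by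
    intro j
    have hmem : ∀ i l : n, ∀ z ∈ Finset.univ.filter (fun z : R → W =>
        (occupied φ z).Nonempty ∧ z (sel (occupied φ z)) = φ i),
        Function.update z (sel (occupied φ z)) (φ l) ∈ Finset.univ.filter (fun z : R → W =>
        (occupied φ z).Nonempty ∧ z (sel (occupied φ z)) = φ l) := by
      intro i l z hz
      rw [Finset.mem_filter] at hz ⊢
      rw [occupied_update φ (hsel _ hz.2.1)]
      exact ⟨Finset.mem_univ _, hz.2.1, by simp⟩
    have hinv : ∀ i l : n, ∀ z ∈ Finset.univ.filter (fun z : R → W =>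
        (occupied φ z).Nonempty ∧ z (sel (occupied φ z)) = φ i),
        Function.update (Function.update z (sel (occupied φ z)) (φ l))
          (sel (occupied φ (Function.update z (sel (occupied φ z)) (φ l)))) (φ i) = z := by
      intro i l z hz
      rw [Finset.mem_filter] at hz
      rw [occupied_update φ (hsel _ hz.2.1), Function.update_idem, ← hz.2.2,
        Function.update_eq_self]
    exact Finset.sum_bij' (fun z _ => Function.update z (sel (occupied φ z)) (φ k))
      (fun z _ => Function.update z (sel (occupied φ z)) (φ j)) (hmem j k) (hmem k j)
      (hinv j k) (hinv k j) fun z _ => rfl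
  have hdiff : ∑ z : R → W, (p (swapMap φ sel (k, z)).1 - γ (swapMap φ sel (k, z)).1) *
      ∏ r, P ((swapMap φ sel (k, z)).2 r) = (1 - c) ^ Fintype.card R * (p k - γ k) := by
    rw [← Finset.sum_filter_add_sum_filter_not _ fun z : R → W => (occupied φ z).Nonempty]
    have hA : ∑ z : R → W with ¬ (occupied φ z).Nonempty,
        (p (swapMap φ sel (k, z)).1 - γ (swapMap φ sel (k, z)).1) *
        ∏ r, P ((swapMap φ sel (k, z)).2 r) = (1 - c) ^ Fintype.card R * (p k - γ k) := by
      rw [← hnone, Finset.sum_mul]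
      refine Finset.sum_congr rfl fun z hz => ?_
      rw [swapMap_of_empty (Finset.mem_filter.mp hz).2]
      ring
    have hB : ∑ z : R → W with (occupied φ z).Nonempty,
        (p (swapMap φ sel (k, z)).1 - γ (swapMap φ sel (k, z)).1) *
        ∏ r, P ((swapMap φ sel (k, z)).2 r) = 0 := by
      have hz : ∀ z ∈ Finset.univ.filter (fun z : R → W => (occupied φ z).Nonempty),
          (p (swapMap φ sel (k, z)).1 - γ (swapMap φ sel (k, z)).1) *
            ∏ r, P ((swapMap φ sel (k, z)).2 r) =
          ∑ j, if z (sel (occupied φ z)) = φ j then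
            (p j - γ j) * ∏ r, P (Function.update z (sel (occupied φ z)) (φ k) r) else 0 := by
        intro z hz
        have h := (Finset.mem_filter.mp hz).2
        obtain ⟨j, hj⟩ := exists_apply_sel hsel h
        rw [swapMap_of_nonempty hφ k h hj]
        simp only [hj, hφ.eq_iff]
        rw [Finset.sum_ite_eq Finset.univ j, if_pos (Finset.mem_univ _)]
      rw [Finset.sum_congr rfl hz, Finset.sum_comm]
      simp only [← Finset.sum_filter, Finset.filter_filter, ← Finset.mul_sum, hocc]
      rw [← Finset.sum_mul, Finset.sum_sub_distrib, hp, hγ1, sub_self, zero_mul]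
    rw [hA, hB, zero_add]
  rw [← hdiff]
  refine Eq.trans ?_ (congrArg (· + _) hγs)
  rw [← Finset.sum_add_distrib]
  exact Finset.sum_congr rfl fun z _ => by ring

end Swap

/-! ### Permutation matrices with phases -/

section PhasedPerm

variable {K : Type*} [Fintype K] [DecidableEq K]

/-- The matrix of a permutation of the basis followed by phases. -/
def phasedPerm (π : Equiv.Perm K) (s : K → ℂ) : Matrix K K ℂ :=
  of fun a b => if π a = b then s a else 0

theorem phasedPerm_conj (π : Equiv.Perm K) (s : K → ℂ) (A : Matrix K K ℂ) (a b : K) :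
    (phasedPerm π s * A * (phasedPerm π s)ᴴ) a b = s a * star (s b) * A (π a) (π b) := by
  simp only [phasedPerm, mul_apply, conjTranspose_apply, of_apply, ite_mul, zero_mul,
    Finset.sum_ite_eq, Finset.mem_univ, if_true, apply_ite star, star_zero, mul_ite, mul_zero]
  ring

theorem phasedPerm_mem_unitaryGroup (π : Equiv.Perm K) {s : K → ℂ} (hs : ∀ a, s a * star (s a) = 1) :
    phasedPerm π s ∈ unitaryGroup K ℂ := by
  rw [mem_unitaryGroup_iff, star_eq_conjTranspose]
  ext a b
  have := phasedPerm_conj π s 1 a b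
  rw [mul_one] at this
  rw [this, one_apply, one_apply]
  by_cases h : a = b
  · subst h; rw [hs, if_pos rfl, if_pos rfl, mul_one]
  · simp [h, π.injective.ne h]

theorem commute_phasedPerm_diagonal {π : Equiv.Perm K} (s : K → ℂ) {h : K → ℂ}
    (hh : ∀ a, h (π a) = h a) : Commute (phasedPerm π s) (diagonal h) := by
  rw [Commute, SemiconjBy]
  ext a b
  rw [mul_diagonal, diagonal_mul]
  simp only [phasedPerm, of_apply, ite_mul, mul_ite, mul_zero, zero_mul]
  split_ifs with hab
  · rw [← hab, hh, mul_comm]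
  · rfl

end PhasedPerm

end ExactEnergy

namespace ExactEnergy

/-! ### Environments of qubits -/

section Qubits

/-- An environment of qubits with the given energy gaps. -/
noncomputable abbrev qubitEnvironment {N : ℕ} (g : Fin N → ℝ) : Environment where
  N := N
  dim _ := 2
  dim_pos _ := two_pos
  ham i := diagHam ![0, g i]
  ham_herm _ := diagHam_isHermitian _

theorem qubitEnvironment_hamiltonian {N : ℕ} (g : Fin N → ℝ) :
    (qubitEnvironment g).hamiltonian =
      diagHam fun x : Fin N → Fin 2 => ∑ i, (![0, g i] : Fin 2 → ℝ) (x i) := by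
  ext x y
  rw [Environment.hamiltonian, Matrix.sum_apply]
  by_cases h : x = y
  · subst h
    rw [diagHam, diagonal_apply_eq, Complex.ofReal_sum]
    refine Finset.sum_congr rfl fun i _ => ?_
    rw [Environment.tensor_update_apply, Finset.prod_eq_one fun j _ => one_apply_eq _, mul_one]
    exact diagonal_apply_eq _ _
  · rw [diagHam, diagonal_apply_ne _ h]
    obtain ⟨j, hj⟩ := Function.ne_iff.mp h
    refine Finset.sum_eq_zero fun i _ => ?_
    rw [Environment.tensor_update_apply]
    by_cases hij : j = i
    · subst hij
      exact mul_eq_zero_of_left (diagonal_apply_ne _ hj) _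
    · exact mul_eq_zero_of_right _
        (Finset.prod_eq_zero (Finset.mem_erase.mpr ⟨hij, Finset.mem_univ j⟩) (one_apply_ne hj))

theorem qubitEnvironment_totalHamiltonian {n : Type*} [DecidableEq n] (E : n → ℝ) {N : ℕ}
    (g : Fin N → ℝ) : (qubitEnvironment g).totalHamiltonian (diagHam E) =
      diagHam fun a : n × (Fin N → Fin 2) =>
        E a.1 + ∑ i, (![0, g i] : Fin 2 → ℝ) (a.2 i) := by
  rw [Environment.totalHamiltonian, qubitEnvironment_hamiltonian]
  ext ⟨i, x⟩ ⟨j, y⟩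
  simp only [diagHam, Matrix.add_apply, kroneckerMap_apply, diagonal_apply, one_apply, Prod.mk.injEq]
  by_cases h1 : i = j <;> by_cases h2 : x = y
  · simp [h1, h2]
  · simp [h1, h2]
  · simp [h1, h2]
  · simp [h1, h2]

/-- The mean energy of a non-degenerate qubit determines its populations. -/
theorem apply_diag_of_mem_macrostate_qubit {β g : ℝ} (hg : g ≠ 0) {τ : Matrix (Fin 2) (Fin 2) ℂ}
    (hτ : τ ∈ macrostate (thermalEnergy β (diagHam ![0, g])) (diagHam ![0, g])) (b : Fin 2) :
    τ b b = (boltzmann β ![0, g] b : ℂ) := by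
  obtain ⟨h1, h2⟩ := hτ
  rw [thermalEnergy, gibbs_diagHam, meanEnergy_diagHam, meanEnergy_diagHam] at h2
  have h3 := h1.sum_re_diag
  have h4 := sum_boltzmann β ![0, g]
  simp only [Fin.sum_univ_two, diagHam, diagonal_apply_eq, Complex.ofReal_re] at h2 h3 h4
  simp only [cons_val_zero, cons_val_one, mul_zero, zero_add] at h2
  have h5 := mul_right_cancel₀ hg h2
  rw [← h1.1.ofReal_re_diag]
  congr 1
  fin_cases b
  · simp only [Fin.zero_eta]; linarith
  · exact h5

variable {n : Type*} [Fintype n] [DecidableEq n]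

/-- Commuting macrostate operations with an environment of qubits whose basis states are
labelled by `X`. -/
theorem exists_environment_of_qubits {β e δ : ℝ} (hδ : 0 ≤ δ) {E : n → ℝ} {ρf : Matrix n n ℂ}
    {ι X : Type*} [Fintype ι] [Fintype X] [DecidableEq X] (Ψ : X ≃ (ι → Fin 2)) {g : ι → ℝ}
    (hg : ∀ i, g i ≠ 0) {U : Matrix (n × X) (n × X) ℂ} (hU : U ∈ unitaryGroup (n × X) ℂ)
    (hc : Commute U (diagonal fun a : n × X =>
      ((E a.1 + ∑ i, (![0, g i] : Fin 2 → ℝ) (Ψ a.2 i) : ℝ) : ℂ)))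
    (h : ∀ ρ ∈ macrostate e (diagHam E), ∀ τ : ι → Matrix (Fin 2) (Fin 2) ℂ,
      (∀ i, (τ i).PosSemidef) → (∀ i b, τ i b b = (boltzmann β ![0, g i] b : ℂ)) →
      ∀ k l, ‖ρf k l - ∑ x, (U * (of fun a b : n × X =>
        ρ a.1 b.1 * ∏ i, τ i (Ψ a.2 i) (Ψ b.2 i)) * Uᴴ) (k, x) (l, x)‖ ≤ δ) :
    ∃ Env : Environment, ∃ U ∈ unitaryGroup (n × Env.Idx) ℂ,
      Commute U (Env.totalHamiltonian (diagHam E)) ∧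
      ∀ ρ ∈ macrostate e (diagHam E),
        ∀ ρE : (∀ i, Matrix (Fin (Env.dim i)) (Fin (Env.dim i)) ℂ),
          (∀ i, ρE i ∈ macrostate (thermalEnergy β (Env.ham i)) (Env.ham i)) →
          traceNorm (ρf - Env.evolve U ρ ρE) ≤ (Fintype.card n : ℝ) ^ 2 * δ := by
  let v : Fin (Fintype.card ι) ≃ ι := (Fintype.equivFin ι).symm
  let f : (Fin (Fintype.card ι) → Fin 2) ≃ X := (Equiv.arrowCongr v (Equiv.refl _)).trans Ψ.symm
  have hf : ∀ x m, Ψ (f x) (v m) = x m := by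
    intro x m
    simp [f, Equiv.arrowCongr]
  let F : n × (Fin (Fintype.card ι) → Fin 2) ≃ n × X := (Equiv.refl n).prodCongr f
  have hsum : ∀ x, ∑ m, (![0, g (v m)] : Fin 2 → ℝ) (x m) =
      ∑ i, (![0, g i] : Fin 2 → ℝ) (Ψ (f x) i) := by
    intro x
    rw [← v.sum_comp]
    simp only [hf]
  refine ⟨qubitEnvironment (g ∘ v), U.submatrix F F, ?_, ?_, ?_⟩
  · rw [mem_unitaryGroup_iff, star_eq_conjTranspose] at hU ⊢
    rw [conjTranspose_submatrix]
    exact (submatrix_mul_equiv U Uᴴ F F F).trans (by rw [hU]; exact submatrix_one_equiv F)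
  · rw [qubitEnvironment_totalHamiltonian]
    have hD : diagHam (fun a : n × (Fin (Fintype.card ι) → Fin 2) =>
        E a.1 + ∑ m, (![0, (g ∘ v) m] : Fin 2 → ℝ) (a.2 m)) = (diagonal fun a : n × X =>
      ((E a.1 + ∑ i, (![0, g i] : Fin 2 → ℝ) (Ψ a.2 i) : ℝ) : ℂ)).submatrix F F := by
      rw [submatrix_diagonal_equiv, diagHam]
      congr 1
      funext a
      simp only [Function.comp_apply, hsum]
      rfl
    rw [hD]
    have h1 := congrArg (fun A => A.submatrix F F) hc.eq
    exact ((submatrix_mul_equiv _ _ F F F).trans h1).trans (submatrix_mul_equiv _ _ F F F).symm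
  · intro ρ hρ ρE hρE
    refine traceNorm_le_of_norm_apply_le hδ fun k l => ?_
    have hmem : ∀ i, ρE (v.symm i) ∈ macrostate (thermalEnergy β (diagHam ![0, g i]))
        (diagHam ![0, g i]) := by
      intro i
      have := hρE (v.symm i)
      simp only [qubitEnvironment, Function.comp_apply, Equiv.apply_symm_apply] at this
      exact this
    refine le_trans (le_of_eq ?_) (h ρ hρ (fun i => ρE (v.symm i)) (fun i => (hmem i).1.1)
      (fun i b => apply_diag_of_mem_macrostate_qubit (hg i) (hmem i) b) k l)
    rw [Matrix.sub_apply]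
    congr 2
    have hT : (ρ ⊗ₖ (qubitEnvironment (g ∘ v)).tensor ρE) = (of fun a b : n × X =>
        ρ a.1 b.1 * ∏ i, ρE (v.symm i) (Ψ a.2 i) (Ψ b.2 i)).submatrix F F := by
      ext a b
      rw [kroneckerMap_apply, submatrix_apply, of_apply]
      congr 1
      rw [← v.prod_comp, Environment.tensor, of_apply]
      refine Finset.prod_congr rfl fun m _ => ?_
      have ha : Ψ (F a).2 (v m) = a.2 m := hf _ _
      have hb : Ψ (F b).2 (v m) = b.2 m := hf _ _
      rw [ha, hb]
      have : ∀ m', m' = m → ρE m (a.2 m) (b.2 m) = ρE m' (a.2 m) (b.2 m) := by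
        rintro _ rfl; rfl
      exact this _ (v.symm_apply_apply m)
    rw [Environment.evolve, hT]
    simp only [partialTrace, of_apply]
    rw [← f.sum_comp]
    refine Finset.sum_congr rfl fun x _ => ?_
    rw [conjTranspose_submatrix]
    have e1 := (congrArg (· * Uᴴ.submatrix F F) (submatrix_mul_equiv U (of fun a b : n × X =>
        ρ a.1 b.1 * ∏ i, ρE (v.symm i) (Ψ a.2 i) (Ψ b.2 i)) F F F)).trans
        (submatrix_mul_equiv _ Uᴴ F F F)
    exact congrFun (congrFun e1 (k, x)) (l, x)

end Qubits

end ExactEnergy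

namespace ExactEnergy

/-! ### Reaching the Gibbs state from every macrostate -/

section Thermalization

theorem sum_prod_qubits {n : Type*} [Fintype n] [DecidableEq n] {w : n → Fin 2 → ℝ}
    (hw : ∀ i, ∑ b, w i b = 1) : ∑ y : n → Fin 2, ∏ i, w i (y i) = 1 := by
  rw [← Fintype.piFinset_univ, ← Finset.prod_univ_sum (fun _ => Finset.univ) w,
    Finset.prod_eq_one fun i _ => hw i]

/-- The sign attached to a basis state of a qubit. -/
def qubitSign : Fin 2 → ℂ := ![1, -1]

theorem qubitSign_mul_star (b : Fin 2) : qubitSign b * star (qubitSign b) = 1 := by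
  fin_cases b <;> simp [qubitSign]

/-- Two independent random signs average to the square of their bias. -/
theorem sum_qubitSign {n : Type*} [Fintype n] [DecidableEq n] {w : Fin 2 → ℝ}
    (hw : ∑ b, w b = 1) {k l : n} (hkl : k ≠ l) :
    ∑ y : n → Fin 2, qubitSign (y k) * star (qubitSign (y l)) * ∏ i, (w (y i) : ℂ) =
      (((w 0 - w 1) ^ 2 : ℝ) : ℂ) := by
  have h1 : ∀ y : n → Fin 2, qubitSign (y k) * star (qubitSign (y l)) * ∏ i, (w (y i) : ℂ) =
      ∏ i, (if i = k then qubitSign (y i) else 1) * (if i = l then star (qubitSign (y i)) else 1) *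
        (w (y i) : ℂ) := by
    intro y
    rw [Finset.prod_mul_distrib, Finset.prod_mul_distrib, Finset.prod_ite_eq' Finset.univ k,
      Finset.prod_ite_eq' Finset.univ l, if_pos (Finset.mem_univ _), if_pos (Finset.mem_univ _)]
  have h2 : ∀ i : n, ∑ b : Fin 2, (if i = k then qubitSign b else 1) *
      (if i = l then star (qubitSign b) else 1) * (w b : ℂ) =
      (if i = k then ((w 0 - w 1 : ℝ) : ℂ) else 1) * (if i = l then ((w 0 - w 1 : ℝ) : ℂ) else 1) := by
    intro i
    have hw' : (w 0 : ℂ) + w 1 = 1 := by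
      rw [← Complex.ofReal_add, ← Fin.sum_univ_two w, hw, Complex.ofReal_one]
    by_cases hk : i = k
    · have hl : i ≠ l := fun h => hkl (hk.symm.trans h)
      simp [hk, hkl, Fin.sum_univ_two, qubitSign, sub_eq_add_neg]
    · by_cases hl : i = l
      · simp [hl, hkl.symm, Fin.sum_univ_two, qubitSign, sub_eq_add_neg]
      · simp [hk, hl, Fin.sum_univ_two, hw']
  simp only [h1]
  rw [← Fintype.piFinset_univ, ← Finset.prod_univ_sum (fun _ => Finset.univ) fun i b =>
    (if i = k then qubitSign b else 1) * (if i = l then star (qubitSign b) else 1) * (w b : ℂ)]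
  simp only [h2]
  rw [Finset.prod_mul_distrib, Finset.prod_ite_eq' Finset.univ k,
      Finset.prod_ite_eq' Finset.univ l, if_pos (Finset.mem_univ _), if_pos (Finset.mem_univ _)]
  push_cast
  ring

/-- Qubits with a small gap are almost unbiased. -/
theorem exists_gap_abs_boltzmann_sub_lt (β : ℝ) {δ : ℝ} (hδ : 0 < δ) :
    ∃ g : ℝ, g ≠ 0 ∧ |boltzmann β ![0, g] 0 - boltzmann β ![0, g] 1| < δ := by
  have hcont : Continuous fun g : ℝ => |(1 - Real.exp (-β * g)) / (1 + Real.exp (-β * g))| := by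
    refine (Continuous.div (by fun_prop) (by fun_prop) fun g => ?_).abs
    positivity
  have h0 := hcont.tendsto 0
  have hval : |(1 - Real.exp (-β * 0)) / (1 + Real.exp (-β * 0))| = 0 := by simp
  rw [hval] at h0
  -- The bias tends to `0` with the gap; the punctured neighbourhood keeps the gap nonzero.
  obtain ⟨g, hg1, hg2⟩ := (((h0.mono_left nhdsWithin_le_nhds).eventually_lt_const hδ).and
    (self_mem_nhdsWithin (s := {0}ᶜ))).exists
  refine ⟨g, hg2, ?_⟩
  refine lt_of_eq_of_lt (congrArg abs ?_) hg1
  simp [boltzmann, Fin.sum_univ_two, sub_div]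

variable {n : Type*} [Fintype n] [DecidableEq n] {R : Type*} [Fintype R] [DecidableEq R]

/-- A tuple of `n`-qubit registers together with one more register, as a family of bits. -/
def registerEquiv (R n : Type*) : (R → n → Fin 2) × (n → Fin 2) ≃ (R × n ⊕ n → Fin 2) where
  toFun x := Sum.elim (fun a => x.1 a.1 a.2) x.2
  invFun y := (fun r k => y (Sum.inl (r, k)), fun k => y (Sum.inr k))
  left_inv _ := rfl
  right_inv y := by
    funext i
    rcases i with ⟨r, k⟩ | k <;> rfl

theorem registerEquiv_inl {R n : Type*} (x : (R → n → Fin 2) × (n → Fin 2)) (a : R × n) :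
    registerEquiv R n x (Sum.inl a) = x.1 a.1 a.2 := rfl

theorem registerEquiv_inr {R n : Type*} (x : (R → n → Fin 2) × (n → Fin 2)) (k : n) :
    registerEquiv R n x (Sum.inr k) = x.2 k := rfl

/-- The ratio isolates the dependence on `k`; for thermal qubits it is the Boltzmann factor of the
gap. -/
theorem prod_single_one (u : n → Fin 2 → ℝ) (hu : ∀ i, u i 0 ≠ 0) (k : n) :
    ∏ i, u i ((Pi.single k 1 : n → Fin 2) i) = u k 1 / u k 0 * ∏ i, u i 0 := by
  rw [← Finset.mul_prod_erase _ _ (Finset.mem_univ k),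
    ← Finset.mul_prod_erase _ (fun i => u i 0) (Finset.mem_univ k), Pi.single_eq_same,
    Finset.prod_congr rfl fun i hi => by rw [Pi.single_eq_of_ne (Finset.ne_of_mem_erase hi)]]
  field_simp [hu k]

theorem pi_single_one_injective :
    Function.Injective fun k : n => (Pi.single k 1 : n → Fin 2) := by
  intro k l h
  by_contra hkl
  have := congrFun h k
  simp [Pi.single_eq_of_ne hkl] at this

/-- The probability that exactly one qubit of a register is excited depends on this qubit like its
Boltzmann factor. -/
theorem exists_prod_boltzmann_single [Nonempty n] (β : ℝ) (E : n → ℝ) (c₀ : ℝ) :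
    ∃ c : ℝ, 0 < c ∧ c ≤ 1 ∧ ∀ k, ∏ i, boltzmann β ![0, E i - c₀] ((Pi.single k 1 : n → Fin 2) i) =
      c * boltzmann β E k := by
  have hpos : ∀ i : n, 0 < boltzmann β ![0, E i - c₀] 0 := fun i => boltzmann_pos _ _ _
  have hZ : 0 < ∑ j, Real.exp (-β * E j) :=
    Finset.sum_pos (fun _ _ => Real.exp_pos _) Finset.univ_nonempty
  suffices h : ∀ k, ∏ i, boltzmann β ![0, E i - c₀] ((Pi.single k 1 : n → Fin 2) i) =
      Real.exp (β * c₀) * (∑ j, Real.exp (-β * E j)) * (∏ i, boltzmann β ![0, E i - c₀] 0) *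
        boltzmann β E k by
    refine ⟨_, mul_pos (mul_pos (Real.exp_pos _) hZ) (Finset.prod_pos fun i _ => hpos i), ?_, h⟩
    -- Summed over `k`, the constant is the probability of exactly one excitation, hence at most
    -- `1`.
    rw [← mul_one (_ * ∏ i, boltzmann β ![0, E i - c₀] 0), ← sum_boltzmann β E, Finset.mul_sum,
      Finset.sum_congr rfl fun k _ => (h k).symm, sum_boltzmann,
      ← sum_prod_qubits (w := fun i => boltzmann β ![0, E i - c₀]) fun i => sum_boltzmann _ _,
      ← Finset.sum_image (g := fun k : n => (Pi.single k 1 : n → Fin 2))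
        (f := fun w => ∏ i, boltzmann β ![0, E i - c₀] (w i)) pi_single_one_injective.injOn]
    exact Finset.sum_le_univ_sum_of_nonneg fun w =>
      Finset.prod_nonneg fun i _ => (boltzmann_pos _ _ _).le
  intro k
  rw [prod_single_one (fun i => boltzmann β ![0, E i - c₀]) fun i => (hpos i).ne']
  have h1 : boltzmann β ![0, E k - c₀] 1 / boltzmann β ![0, E k - c₀] 0 =
      Real.exp (β * c₀) * Real.exp (-β * E k) := by
    have : (0 : ℝ) < 1 + Real.exp (-β * (E k - c₀)) := by positivity
    rw [← Real.exp_add]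
    simp only [boltzmann, Fin.sum_univ_two, cons_val_zero, cons_val_one, mul_zero, Real.exp_zero]
    rw [div_div_div_cancel_right₀ this.ne', div_one]
    congr 1
    ring
  rw [h1, boltzmann]
  field_simp

/-- The offset `c₀` is common to all singly excited states and drops out when one replaces another.
-/
theorem sum_pi_single_bit (E : n → ℝ) (c₀ : ℝ) (k : n) :
    ∑ i, (![0, E i - c₀] : Fin 2 → ℝ) ((Pi.single k 1 : n → Fin 2) i) = E k - c₀ := by
  rw [Finset.sum_eq_single k]
  · simp
  · intro i _ hi
    simp [Pi.single_eq_of_ne hi]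
  · simp

variable [Nonempty n]

/-- Energies are conserved when a system is swapped with a singly excited register. -/
theorem swapMap_energy {sel : Finset R → R} (hsel : ∀ s : Finset R, s.Nonempty → sel s ∈ s)
    (E : n → ℝ) (c₀ : ℝ) (a : n × (R → n → Fin 2)) :
    E (swapMap (fun k : n => (Pi.single k 1 : n → Fin 2)) sel a).1 +
      ∑ r, ∑ i, (![0, E i - c₀] : Fin 2 → ℝ)
        ((swapMap (fun k : n => (Pi.single k 1 : n → Fin 2)) sel a).2 r i) =
    E a.1 + ∑ r, ∑ i, (![0, E i - c₀] : Fin 2 → ℝ) (a.2 r i) := by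
  obtain ⟨k, z⟩ := a
  set φ := fun k : n => (Pi.single k 1 : n → Fin 2) with hφ
  by_cases h : (occupied φ z).Nonempty
  · obtain ⟨j, hj⟩ := exists_apply_sel hsel h
    rw [swapMap_of_nonempty pi_single_one_injective k h hj]
    dsimp only
    have hrest : ∑ r ∈ Finset.univ.erase (sel (occupied φ z)), ∑ i, (![0, E i - c₀] : Fin 2 → ℝ)
        (Function.update z (sel (occupied φ z)) (φ k) r i) =
        ∑ r ∈ Finset.univ.erase (sel (occupied φ z)), ∑ i, (![0, E i - c₀] : Fin 2 → ℝ) (z r i) :=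
      Finset.sum_congr rfl fun r hr => by rw [Function.update_of_ne (Finset.ne_of_mem_erase hr)]
    rw [← Finset.add_sum_erase _ _ (Finset.mem_univ (sel (occupied φ z))),
      ← Finset.add_sum_erase _ (fun r => ∑ i, (![0, E i - c₀] : Fin 2 → ℝ) (z r i))
        (Finset.mem_univ (sel (occupied φ z))), hrest, Function.update_self, hj]
    have h1 := sum_pi_single_bit E c₀ k
    have h2 := sum_pi_single_bit E c₀ j
    linarith
  · rw [swapMap_of_empty h]

/-- The matrix elements of the output of the thermalizing operation. -/
theorem norm_thermalize_sub_le {sel : Finset R → R}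
    (hsel : ∀ s : Finset R, s.Nonempty → sel s ∈ s)
    {β c c₀ g : ℝ} {E : n → ℝ} (hc0 : 0 < c) (hc1 : c ≤ 1)
    (hc : ∀ k, ∏ i, boltzmann β ![0, E i - c₀] ((Pi.single k 1 : n → Fin 2) i) =
      c * boltzmann β E k) {ρ : Matrix n n ℂ} (hρ : IsDensity ρ)
    {τ : R × n ⊕ n → Matrix (Fin 2) (Fin 2) ℂ} (hτ : ∀ i, (τ i).PosSemidef)
    (hl : ∀ a b, τ (Sum.inl a) b b = (boltzmann β ![0, E a.2 - c₀] b : ℂ))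
    (hr : ∀ a b, τ (Sum.inr a) b b = (boltzmann β ![0, g] b : ℂ)) (k l : n) :
    ‖gibbs β (diagHam E) k l - ∑ x : (R → n → Fin 2) × (n → Fin 2),
      qubitSign (x.2 k) * star (qubitSign (x.2 l)) *
        (ρ (swapMap (fun k : n => (Pi.single k 1 : n → Fin 2)) sel (k, x.1)).1
          (swapMap (fun k : n => (Pi.single k 1 : n → Fin 2)) sel (l, x.1)).1 *
        ∏ i, τ i
          (registerEquiv R n
            ((swapMap (fun k : n => (Pi.single k 1 : n → Fin 2)) sel (k, x.1)).2, x.2) i)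
          (registerEquiv R n
            ((swapMap (fun k : n => (Pi.single k 1 : n → Fin 2)) sel (l, x.1)).2, x.2) i))‖ ≤
      max ((1 - c) ^ Fintype.card R) ((boltzmann β ![0, g] 0 - boltzmann β ![0, g] 1) ^ 2) := by
  set φ := fun k : n => (Pi.single k 1 : n → Fin 2)
  set S := swapMap (R := R) φ sel
  -- The joint state of the system and the swap registers. Its diagonal is known up to the
  -- populations of `ρ`; its coherences are arbitrary and controlled by positivity alone.
  let B : Matrix (n × (R → n → Fin 2)) (n × (R → n → Fin 2)) ℂ := of fun a b =>
    ρ a.1 b.1 * ∏ i : R × n, τ (Sum.inl i) (a.2 i.1 i.2) (b.2 i.1 i.2)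
  let P : (n → Fin 2) → ℝ := fun w => ∏ i, boltzmann β ![0, E i - c₀] (w i)
  have hP1 : ∑ w, P w = 1 := sum_prod_qubits fun i => sum_boltzmann _ _
  have hB : B.PosSemidef :=
    (hρ.1.kronecker (PosSemidef.prod_apply fun i : R × n => hτ (Sum.inl i))).submatrix
      fun a : n × (R → n → Fin 2) => (a.1, fun i : R × n => a.2 i.1 i.2)
  have hBd : ∀ a, (B a a).re = (ρ a.1 a.1).re * ∏ r, P (a.2 r) := by
    intro a
    simp only [B, of_apply, hl, P, ← Complex.ofReal_prod, Complex.re_mul_ofReal,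
      Fintype.prod_prod_type]
  have hf0 : 0 ≤ (1 - c) ^ Fintype.card R := pow_nonneg (by linarith) _
  have hf1 : (1 - c) ^ Fintype.card R ≤ 1 := pow_le_one₀ (by linarith) (by linarith)
  have hp0 : ∀ k, 0 ≤ (ρ k k).re := hρ.1.re_diag_nonneg
  have hp1 : ∀ k, (ρ k k).re ≤ 1 := fun k =>
    (Finset.single_le_sum (f := fun k => (ρ k k).re) (fun i _ => hp0 i)
      (Finset.mem_univ k)).trans hρ.sum_re_diag.le
  have hγ0 : ∀ k, 0 ≤ boltzmann β E k := fun k => (boltzmann_pos β E k).le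
  have hγ1 : ∀ k, boltzmann β E k ≤ 1 := fun k =>
    (Finset.single_le_sum (fun i _ => hγ0 i) (Finset.mem_univ k)).trans (sum_boltzmann β E).le
  have hD : ∀ k, ∑ z, (B (S (k, z)) (S (k, z))).re = boltzmann β E k +
      (1 - c) ^ Fintype.card R * ((ρ k k).re - boltzmann β E k) := by
    intro k
    simp only [hBd]
    exact sum_swapMap (p := fun k => (ρ k k).re) hsel pi_single_one_injective hP1 hc
      (sum_boltzmann β E) hρ.sum_re_diag k
  have hD1 : ∀ k, ∑ z, (B (S (k, z)) (S (k, z))).re ≤ 1 := by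
    intro k
    rw [hD]
    nlinarith [hp1 k, hγ1 k]
  -- The sign qubits are not moved and are traced out, so only their populations enter.
  have hsplit : ∀ x : (R → n → Fin 2) × (n → Fin 2),
      qubitSign (x.2 k) * star (qubitSign (x.2 l)) * (ρ (S (k, x.1)).1 (S (l, x.1)).1 *
        ∏ i, τ i (registerEquiv R n ((S (k, x.1)).2, x.2) i)
          (registerEquiv R n ((S (l, x.1)).2, x.2) i)) =
      B (S (k, x.1)) (S (l, x.1)) * (qubitSign (x.2 k) * star (qubitSign (x.2 l)) *
        ∏ i, (boltzmann β ![0, g] (x.2 i) : ℂ)) := by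
    intro x
    rw [Fintype.prod_sum_type]
    simp only [registerEquiv_inl, registerEquiv_inr, hr, B, of_apply]
    ring
  simp only [hsplit]
  rw [Fintype.sum_prod_type]
  simp only [← Finset.mul_sum, ← Finset.sum_mul]
  -- On the diagonal the signs cancel and the error is the failure probability of the swap. Off the
  -- diagonal the random signs contribute the squared bias.
  by_cases hkl : k = l
  · subst hkl
    refine le_trans (le_of_eq ?_) ((mul_le_of_le_one_right (b := |boltzmann β E k - (ρ k k).re|)
      hf0 ?_).trans (le_max_left _ _))
    · have h1 : ∑ y : n → Fin 2, qubitSign (y k) * star (qubitSign (y k)) *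
          ∏ i, (boltzmann β ![0, g] (y i) : ℂ) = 1 := by
        simp only [qubitSign_mul_star, one_mul, ← Complex.ofReal_prod, ← Complex.ofReal_sum]
        rw [sum_prod_qubits (w := fun _ : n => boltzmann β ![0, g]) fun i => sum_boltzmann _ _,
          Complex.ofReal_one]
      have h2 : ∑ z, B (S (k, z)) (S (k, z)) = ((∑ z, (B (S (k, z)) (S (k, z))).re : ℝ) : ℂ) := by
        rw [Complex.ofReal_sum]
        exact Finset.sum_congr rfl fun z _ => (hB.ofReal_re_diag _).symm
      rw [h1, h2, hD, mul_one, gibbs_diagHam, diagHam, diagonal_apply_eq, ← Complex.ofReal_sub,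
        Complex.norm_real, Real.norm_eq_abs, ← abs_of_nonneg hf0, ← abs_mul, abs_of_nonneg hf0]
      congr 1
      ring
    · rw [abs_le]
      constructor <;> linarith [hp0 k, hp1 k, hγ0 k, hγ1 k]
  · rw [sum_qubitSign (sum_boltzmann β ![0, g]) hkl, gibbs_diagHam, diagHam,
      diagonal_apply_ne _ hkl, zero_sub, norm_neg, norm_mul, Complex.norm_real,
      Real.norm_eq_abs, abs_of_nonneg (sq_nonneg _)]
    refine (mul_le_of_le_one_left (sq_nonneg _) ?_).trans (le_max_right _ _)
    calc ‖∑ z, B (S (k, z)) (S (l, z))‖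
        ≤ ∑ z, ((B (S (k, z)) (S (k, z))).re + (B (S (l, z)) (S (l, z))).re) / 2 :=
          (norm_sum_le _ _).trans (Finset.sum_le_sum fun z _ => hB.norm_apply_le _ _)
      _ ≤ 1 := by
          rw [← Finset.sum_div, Finset.sum_add_distrib]
          linarith [hD1 k, hD1 l]

/-- The Gibbs state at the temperature of the environments can be reached from every macrostate. -/
theorem commutingMacro_gibbs (β e : ℝ) (E : n → ℝ) :
    CommutingMacro β e (diagHam E) (gibbs β (diagHam E)) := by
  refine ⟨isDensity_gibbs (diagHam_isHermitian E) β, fun ε hε => ?_⟩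
  have hd : (0 : ℝ) < Fintype.card n := by exact_mod_cast Fintype.card_pos
  set δ := ε / (Fintype.card n : ℝ) ^ 2 with hδdef
  have hδ : 0 < δ := by positivity
  have hδe : (Fintype.card n : ℝ) ^ 2 * δ = ε := by rw [hδdef]; field_simp
  -- An offset that is no energy level makes all gaps `E i - c₀` nonzero, so that mean energies fix
  -- the qubit populations.
  obtain ⟨c₀, hc₀⟩ := (Set.finite_range E).infinite_compl.nonempty
  obtain ⟨c, hc0, hc1, hc⟩ := exists_prod_boltzmann_single β E c₀
  obtain ⟨M, hM⟩ := exists_pow_lt_of_lt_one hδ (show 1 - c < 1 by linarith)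
  obtain ⟨g, hg0, hg⟩ := exists_gap_abs_boltzmann_sub_lt β (lt_min hδ one_pos)
  have hMδ : (1 - c) ^ Fintype.card (Fin (M + 1)) ≤ δ := by
    rw [Fintype.card_fin]
    exact (pow_le_pow_of_le_one (by linarith) (by linarith) M.le_succ).trans hM.le
  have hgδ : (boltzmann β ![0, g] 0 - boltzmann β ![0, g] 1) ^ 2 ≤ δ := by
    rw [← sq_abs]
    have h1 := hg.trans_le (min_le_left _ _)
    have h2 := hg.trans_le (min_le_right _ _)
    nlinarith [abs_nonneg (boltzmann β ![0, g] 0 - boltzmann β ![0, g] 1)]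
  -- Having `M + 1` registers guarantees the default value `0`, which the swap never uses.
  let sel : Finset (Fin (M + 1)) → Fin (M + 1) := fun s => if h : s.Nonempty then h.choose else 0
  have hsel : ∀ s : Finset (Fin (M + 1)), s.Nonempty → sel s ∈ s := fun s h => by
    simp only [sel, dif_pos h]
    exact h.choose_spec
  let φ := fun k : n => (Pi.single k 1 : n → Fin 2)
  let S : Equiv.Perm (n × (Fin (M + 1) → n → Fin 2)) :=
    (swapMap_involutive (φ := φ) hsel pi_single_one_injective).toPerm
  let π : Equiv.Perm (n × ((Fin (M + 1) → n → Fin 2) × (n → Fin 2))) :=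
    (Equiv.prodAssoc _ _ _).symm.trans ((S.prodCongr (Equiv.refl _)).trans (Equiv.prodAssoc _ _ _))
  have hπ : ∀ k z y, π (k, (z, y)) = ((swapMap φ sel (k, z)).1, ((swapMap φ sel (k, z)).2, y)) :=
    fun k z y => rfl
  rw [← hδe]
  refine exists_environment_of_qubits hδ.le (registerEquiv (Fin (M + 1)) n)
    (g := Sum.elim (fun a => E a.2 - c₀) fun _ => g) ?_
    (U := phasedPerm π fun a => qubitSign (a.2.2 a.1)) ?_ ?_ ?_
  · rintro (a | a)
    · exact sub_ne_zero.mpr fun h => hc₀ ⟨a.2, h⟩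
    · exact hg0
  · exact phasedPerm_mem_unitaryGroup π fun a => qubitSign_mul_star _
  · refine commute_phasedPerm_diagonal _ ?_
    rintro ⟨k, z, y⟩
    have := swapMap_energy hsel E c₀ (k, z)
    congr 1
    simp only [Fintype.sum_sum_type, Fintype.sum_prod_type, hπ, registerEquiv_inl,
      registerEquiv_inr, Sum.elim_inl, Sum.elim_inr, ← add_assoc]
    exact congrArg (· + _) this
  · intro ρ hρ τ hτ hpop k l
    refine le_trans (le_of_eq ?_) ((norm_thermalize_sub_le hsel hc0 hc1 hc hρ.1 hτ
      (fun a b => hpop (Sum.inl a) b) (fun a b => hpop (Sum.inr a) b) k l).trans (max_le hMδ hgδ))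
    congr 2
    refine Finset.sum_congr rfl fun x _ => ?_
    rw [phasedPerm_conj]
    rfl

end Thermalization

end ExactEnergy

namespace ExactEnergy

variable {n : Type*} [Fintype n] [DecidableEq n]

/-! ### Closedness of the reachable sets and existence of maxima -/

section Compact

theorem isClosed_setOf_isDensity : IsClosed {ρ : Matrix n n ℂ | IsDensity ρ} := by
  have h1 : IsClosed {ρ : Matrix n n ℂ | ρ.PosSemidef} := by
    simp only [posSemidef_iff_dotProduct_mulVec, Set.ofPred_and, Set.ofPred_forall]
    refine IsClosed.inter ?_ (isClosed_iInter fun x => ?_)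
    · exact isClosed_eq (by fun_prop) continuous_id
    · exact isClosed_le continuous_const (by fun_prop)
  exact h1.inter (isClosed_eq (by fun_prop) continuous_const)

theorem IsDensity.norm_apply_le_one {ρ : Matrix n n ℂ} (h : IsDensity ρ) (i j : n) :
    ‖ρ i j‖ ≤ 1 := by
  have h1 : ∀ k, (ρ k k).re ≤ 1 := fun k =>
    (Finset.single_le_sum (f := fun k => (ρ k k).re) (fun i _ => h.1.re_diag_nonneg i)
      (Finset.mem_univ k)).trans h.sum_re_diag.le
  linarith [h.1.norm_apply_le i j, h1 i, h1 j]

/-- The mean energy attains a maximum on every nonempty closed set of density matrices. -/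
theorem exists_isGreatest_meanEnergy (H : Matrix n n ℂ) {S : Set (Matrix n n ℂ)}
    (hne : S.Nonempty) (hS : ∀ ρ ∈ S, IsDensity ρ)
    (hcl : ∀ ρ, IsDensity ρ → (∀ ε : ℝ, 0 < ε → ∃ σ ∈ S, ∀ i j, ‖ρ i j - σ i j‖ ≤ ε) → ρ ∈ S) :
    ∃ a, IsGreatest (meanEnergy H '' S) a := by
  have hclosed : IsClosed S := by
    refine isClosed_of_closure_subset fun ρ hρ => hcl ρ ?_ fun ε hε => ?_
    · exact closure_minimal (t := {ρ : Matrix n n ℂ | IsDensity ρ}) (fun σ hσ => hS σ hσ)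
        isClosed_setOf_isDensity hρ
    · have hU : ∀ᶠ σ in nhds ρ, ∀ i j, ‖ρ i j - σ i j‖ < ε := by
        refine Filter.eventually_all.mpr fun i => Filter.eventually_all.mpr fun j => ?_
        have hc : Continuous fun σ : Matrix n n ℂ => ‖ρ i j - σ i j‖ := by fun_prop
        have := hc.tendsto ρ
        rw [sub_self, norm_zero] at this
        exact this.eventually_lt_const hε
      obtain ⟨σ, hσ1, hσ2⟩ := mem_closure_iff_nhds.mp hρ _ hU
      exact ⟨σ, hσ2, fun i j => (hσ1 i j).le⟩
  have hcompact : IsCompact S := by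
    have hK : IsCompact (Set.univ.pi fun _ : n => Set.univ.pi fun _ : n =>
        Metric.closedBall (0 : ℂ) 1) :=
      isCompact_univ_pi fun _ => isCompact_univ_pi fun _ => isCompact_closedBall _ _
    refine IsCompact.of_isClosed_subset (s := (show Set (Matrix n n ℂ) from
      Set.univ.pi fun _ : n => Set.univ.pi fun _ : n => Metric.closedBall (0 : ℂ) 1)) hK hclosed ?_
    intro ρ hρ i _ j _
    rw [mem_closedBall_zero_iff]
    exact (hS ρ hρ).norm_apply_le_one i j
  refine (hcompact.image ?_).exists_isGreatest (hne.image _)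
  unfold meanEnergy
  fun_prop

theorem traceNorm_sub_le_of_near {ρ σ τ : Matrix n n ℂ} {δ : ℝ} (hδ : 0 ≤ δ)
    (h1 : ∀ i j, ‖ρ i j - σ i j‖ ≤ δ) (h2 : traceNorm (σ - τ) ≤ δ) :
    traceNorm (ρ - τ) ≤ (Fintype.card n : ℝ) ^ 2 * (2 * δ) := by
  refine traceNorm_le_of_norm_apply_le (by linarith) fun i j => ?_
  have h3 := (norm_apply_le_traceNorm (σ - τ) i j).trans h2
  have h4 : (ρ - τ) i j = (ρ i j - σ i j) + (σ - τ) i j := by simp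
  rw [h4]
  linarith [norm_add_le (ρ i j - σ i j) ((σ - τ) i j), h1 i j]

theorem exists_pos_mul_le (C : ℝ) {ε : ℝ} (hε : 0 < ε) : ∃ δ : ℝ, 0 < δ ∧ C * δ ≤ ε := by
  refine ⟨ε / (|C| + 1), by positivity, ?_⟩
  rw [mul_div_assoc', div_le_iff₀ (by positivity)]
  nlinarith [le_abs_self C]

theorem CommutingMacro.of_near {β e : ℝ} {H ρ : Matrix n n ℂ} (hρ : IsDensity ρ)
    (h : ∀ ε : ℝ, 0 < ε → ∃ σ ∈ {σ | CommutingMacro β e H σ}, ∀ i j, ‖ρ i j - σ i j‖ ≤ ε) :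
    CommutingMacro β e H ρ := by
  refine ⟨hρ, fun ε hε => ?_⟩
  obtain ⟨δ, hδ, hδε⟩ := exists_pos_mul_le ((Fintype.card n : ℝ) ^ 2 * 2) hε
  obtain ⟨σ, hσ, hn⟩ := h δ hδ
  obtain ⟨Env, U, hU, hc, happ⟩ := hσ.2 δ hδ
  refine ⟨Env, U, hU, hc, fun ρ' hρ' ρE hρE =>
    (traceNorm_sub_le_of_near hδ.le hn (happ ρ' hρ' ρE hρE)).trans ?_⟩
  rwa [← mul_assoc]

theorem CommutingMicro.of_near {β : ℝ} {H γ ρ : Matrix n n ℂ} (hρ : IsDensity ρ)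
    (h : ∀ ε : ℝ, 0 < ε → ∃ σ ∈ {σ | CommutingMicro β H γ σ}, ∀ i j, ‖ρ i j - σ i j‖ ≤ ε) :
    CommutingMicro β H γ ρ := by
  refine ⟨hρ, fun ε hε => ?_⟩
  obtain ⟨δ, hδ, hδε⟩ := exists_pos_mul_le ((Fintype.card n : ℝ) ^ 2 * 2) hε
  obtain ⟨σ, hσ, hn⟩ := h δ hδ
  obtain ⟨Env, U, hU, hc, happ⟩ := hσ.2 δ hδ
  refine ⟨Env, U, hU, hc, (traceNorm_sub_le_of_near hδ.le hn happ).trans ?_⟩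
  rwa [← mul_assoc]

end Compact

/-- Every state can be reached from itself. -/
theorem commutingMicro_self (β : ℝ) {H ρ : Matrix n n ℂ} (hρ : IsDensity ρ) :
    CommutingMicro β H ρ ρ := by
  refine ⟨hρ, fun ε hε => ?_⟩
  -- The environment without systems, with the identity as unitary.
  let Env : Environment := ⟨0, finZeroElim, finZeroElim, finZeroElim, finZeroElim⟩
  refine ⟨Env, 1, one_mem _, Commute.one_left _, ?_⟩
  rw [Env.evolve_of_commute (one_mem _) (fun i => (Env.isDensity_gibbs_ham β i).2)
    (Commute.one_left _), sub_self]
  refine (traceNorm_le_of_norm_apply_le le_rfl fun i j => ?_).trans (by simpa using hε.le)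
  simp

/-! ### Change of basis of the system -/

section Conjugation

theorem IsDensity.conj {ρ : Matrix n n ℂ} (h : IsDensity ρ) (V : unitaryGroup n ℂ) :
    IsDensity ((V : Matrix n n ℂ) * ρ * (V : Matrix n n ℂ)ᴴ) := by
  refine ⟨h.1.mul_mul_conjTranspose_same _, ?_⟩
  rw [trace_mul_cycle, ← star_eq_conjTranspose, Unitary.coe_star_mul_self, one_mul, h.2]

theorem meanEnergy_conj (H ρ : Matrix n n ℂ) (V : unitaryGroup n ℂ) :
    meanEnergy ((V : Matrix n n ℂ) * H * (V : Matrix n n ℂ)ᴴ)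
      ((V : Matrix n n ℂ) * ρ * (V : Matrix n n ℂ)ᴴ) = meanEnergy H ρ := by
  have hV : (V : Matrix n n ℂ)ᴴ * V = 1 := Unitary.coe_star_mul_self V
  have h : (V : Matrix n n ℂ) * ρ * (V : Matrix n n ℂ)ᴴ * (V * H * (V : Matrix n n ℂ)ᴴ) =
      V * (ρ * H) * (V : Matrix n n ℂ)ᴴ := by
    simp only [mul_assoc]
    rw [← mul_assoc _ (V : Matrix n n ℂ) (H * _), hV, one_mul]
  rw [meanEnergy, h, trace_mul_cycle, hV, one_mul, meanEnergy]

theorem conj_conj_star (A : Matrix n n ℂ) (V : unitaryGroup n ℂ) :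
    (V : Matrix n n ℂ) * (((star V : unitaryGroup n ℂ) : Matrix n n ℂ) * A *
      ((star V : unitaryGroup n ℂ) : Matrix n n ℂ)ᴴ) * (V : Matrix n n ℂ)ᴴ = A := by
  have hV : (V : Matrix n n ℂ) * (V : Matrix n n ℂ)ᴴ = 1 := Unitary.coe_mul_star_self V
  rw [Unitary.coe_star, star_eq_conjTranspose, conjTranspose_conjTranspose]
  simp only [mul_assoc]
  rw [hV, mul_one, ← mul_assoc, hV, one_mul]

/-- The trace norm is in fact invariant; this cruder bound from the entries suffices because
reachability allows every tolerance. -/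
theorem traceNorm_conj_le (A : Matrix n n ℂ) (V : unitaryGroup n ℂ) :
    traceNorm ((V : Matrix n n ℂ) * A * (V : Matrix n n ℂ)ᴴ) ≤
      (Fintype.card n : ℝ) ^ 4 * traceNorm A := by
  have h0 : 0 ≤ traceNorm A := Finset.sum_nonneg fun i _ => Real.sqrt_nonneg _
  refine (traceNorm_le_of_norm_apply_le
    (δ := (Fintype.card n : ℝ) ^ 2 * traceNorm A) (by positivity) fun i j => ?_).trans
    (le_of_eq (by ring))
  rw [mul_apply]
  simp only [mul_apply, Finset.sum_mul, conjTranspose_apply]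
  calc _ ≤ ∑ _k : n, ∑ _l : n, traceNorm A := by
        refine (norm_sum_le _ _).trans (Finset.sum_le_sum fun k _ =>
          (norm_sum_le _ _).trans (Finset.sum_le_sum fun l _ => ?_))
        rw [norm_mul, norm_mul, norm_star]
        have h1 := entry_norm_bound_of_unitary V.2 i l
        have h2 := entry_norm_bound_of_unitary V.2 j k
        have h3 := norm_apply_le_traceNorm A l k
        calc _ ≤ 1 * traceNorm A * 1 := by gcongr
          _ = _ := by ring
    _ = _ := by simp; ring

theorem gibbs_conj (β : ℝ) (H : Matrix n n ℂ) (V : unitaryGroup n ℂ) :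
    gibbs β ((V : Matrix n n ℂ) * H * (V : Matrix n n ℂ)ᴴ) =
      (V : Matrix n n ℂ) * gibbs β H * (V : Matrix n n ℂ)ᴴ := by
  have hV : (V : Matrix n n ℂ)ᴴ * V = 1 := Unitary.coe_star_mul_self V
  have hinv : (V : Matrix n n ℂ)⁻¹ = (V : Matrix n n ℂ)ᴴ := inv_eq_left_inv hV
  have hu : IsUnit (V : Matrix n n ℂ) := (Unitary.toUnits V).isUnit
  have h : NormedSpace.exp ((-β : ℂ) • ((V : Matrix n n ℂ) * H * (V : Matrix n n ℂ)ᴴ)) =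
      (V : Matrix n n ℂ) * NormedSpace.exp ((-β : ℂ) • H) * (V : Matrix n n ℂ)ᴴ := by
    rw [← hinv, ← Matrix.exp_conj _ _ hu, mul_smul_comm, smul_mul_assoc]
  rw [gibbs, h, trace_mul_cycle, hV, one_mul, gibbs, mul_smul_comm, smul_mul_assoc]

theorem partialTrace_conj {m : Type*} [Fintype m] [DecidableEq m]
    (A : Matrix (n × m) (n × m) ℂ) (V : Matrix n n ℂ) :
    partialTrace ((V ⊗ₖ (1 : Matrix m m ℂ)) * A * (V ⊗ₖ (1 : Matrix m m ℂ))ᴴ) =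
      V * partialTrace A * Vᴴ := by
  ext i j
  simp only [partialTrace, of_apply, mul_apply, conjTranspose_apply, kroneckerMap_apply,
    Fintype.sum_prod_type, one_apply, mul_ite, mul_one, mul_zero, ite_mul, zero_mul,
    Finset.sum_ite_eq, Finset.mem_univ, if_true, apply_ite star, star_zero, Finset.sum_mul,
    Finset.mul_sum]
  rw [Finset.sum_comm]
  refine Finset.sum_congr rfl fun k _ => ?_
  rw [Finset.sum_comm]

/-- Change of basis of the system for an operation on system and environment. -/
theorem Environment.exists_conj (Env : Environment) (V : unitaryGroup n ℂ) {H : Matrix n n ℂ}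
    {U : Matrix (n × Env.Idx) (n × Env.Idx) ℂ} (hU : U ∈ unitaryGroup (n × Env.Idx) ℂ)
    (hc : Commute U (Env.totalHamiltonian H)) :
    ∃ U' ∈ unitaryGroup (n × Env.Idx) ℂ,
      Commute U' (Env.totalHamiltonian ((V : Matrix n n ℂ) * H * (V : Matrix n n ℂ)ᴴ)) ∧
      ∀ ρ ρE, Env.evolve U' ((V : Matrix n n ℂ) * ρ * (V : Matrix n n ℂ)ᴴ) ρE =
        (V : Matrix n n ℂ) * Env.evolve U ρ ρE * (V : Matrix n n ℂ)ᴴ := by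
  set W : Matrix (n × Env.Idx) (n × Env.Idx) ℂ := (V : Matrix n n ℂ) ⊗ₖ 1 with hWdef
  have hV1 : (V : Matrix n n ℂ)ᴴ * V = 1 := Unitary.coe_star_mul_self V
  have hV2 : (V : Matrix n n ℂ) * (V : Matrix n n ℂ)ᴴ = 1 := Unitary.coe_mul_star_self V
  have hWs : Wᴴ = (V : Matrix n n ℂ)ᴴ ⊗ₖ 1 := by
    rw [hWdef, conjTranspose_kronecker, conjTranspose_one]
  have hW1 : Wᴴ * W = 1 := by
    rw [hWs, hWdef, ← mul_kronecker_mul, hV1, one_mul, one_kronecker_one]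
  have hW2 : W * Wᴴ = 1 := by
    rw [hWs, hWdef, ← mul_kronecker_mul, hV2, one_mul, one_kronecker_one]
  have hUm : U * Uᴴ = 1 := mem_unitaryGroup_iff.mp hU
  have hmul : ∀ A B : Matrix (n × Env.Idx) (n × Env.Idx) ℂ,
      W * A * Wᴴ * (W * B * Wᴴ) = W * (A * B) * Wᴴ := by
    intro A B
    simp only [mul_assoc]
    rw [← mul_assoc Wᴴ W, hW1, one_mul]
  have hconj : (W * U * Wᴴ)ᴴ = W * Uᴴ * Wᴴ := by
    simp only [conjTranspose_mul, conjTranspose_conjTranspose, mul_assoc]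
  refine ⟨W * U * Wᴴ, ?_, ?_, fun ρ ρE => ?_⟩
  · rw [mem_unitaryGroup_iff, star_eq_conjTranspose, hconj, hmul, hUm, mul_one, hW2]
  · have hT : Env.totalHamiltonian ((V : Matrix n n ℂ) * H * (V : Matrix n n ℂ)ᴴ) =
        W * Env.totalHamiltonian H * Wᴴ := by
      rw [Environment.totalHamiltonian, Environment.totalHamiltonian, mul_add, add_mul, hWs, hWdef]
      simp only [← mul_kronecker_mul, one_mul, mul_one, hV2]
    rw [hT, Commute, SemiconjBy, hmul, hmul, hc.eq]
  · have hR : ((V : Matrix n n ℂ) * ρ * (V : Matrix n n ℂ)ᴴ) ⊗ₖ Env.tensor ρE =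
        W * (ρ ⊗ₖ Env.tensor ρE) * Wᴴ := by
      rw [hWs, hWdef, ← mul_kronecker_mul, ← mul_kronecker_mul, one_mul, mul_one]
    rw [Environment.evolve, Environment.evolve, hconj, hR, hmul, hmul, partialTrace_conj]

theorem CommutingMacro.conj {β e : ℝ} {H ρf : Matrix n n ℂ} (h : CommutingMacro β e H ρf)
    (V : unitaryGroup n ℂ) : CommutingMacro β e ((V : Matrix n n ℂ) * H * (V : Matrix n n ℂ)ᴴ)
      ((V : Matrix n n ℂ) * ρf * (V : Matrix n n ℂ)ᴴ) := by
  refine ⟨h.1.conj V, fun ε hε => ?_⟩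
  obtain ⟨δ, hδ, hδε⟩ := exists_pos_mul_le ((Fintype.card n : ℝ) ^ 4) hε
  obtain ⟨Env, U, hU, hc, happ⟩ := h.2 δ hδ
  obtain ⟨U', hU', hc', hev⟩ := Env.exists_conj V hU hc
  refine ⟨Env, U', hU', hc', fun ρ hρ ρE hρE => ?_⟩
  have hρ2 := conj_conj_star ρ V
  set σ := ((star V : unitaryGroup n ℂ) : Matrix n n ℂ) * ρ *
    ((star V : unitaryGroup n ℂ) : Matrix n n ℂ)ᴴ with hσ
  have hσm : σ ∈ macrostate e H := by
    refine ⟨hρ.1.conj (star V), ?_⟩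
    rw [← meanEnergy_conj H σ V, hρ2, hρ.2]
  rw [← hρ2, hev, ← sub_mul, ← mul_sub]
  refine (traceNorm_conj_le _ V).trans (le_trans ?_ hδε)
  gcongr
  exact happ σ hσm ρE hρE

theorem CommutingMicro.conj {β : ℝ} {H γ ρf : Matrix n n ℂ} (h : CommutingMicro β H γ ρf)
    (V : unitaryGroup n ℂ) : CommutingMicro β ((V : Matrix n n ℂ) * H * (V : Matrix n n ℂ)ᴴ)
      ((V : Matrix n n ℂ) * γ * (V : Matrix n n ℂ)ᴴ)
      ((V : Matrix n n ℂ) * ρf * (V : Matrix n n ℂ)ᴴ) := by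
  refine ⟨h.1.conj V, fun ε hε => ?_⟩
  obtain ⟨δ, hδ, hδε⟩ := exists_pos_mul_le ((Fintype.card n : ℝ) ^ 4) hε
  obtain ⟨Env, U, hU, hc, happ⟩ := h.2 δ hδ
  obtain ⟨U', hU', hc', hev⟩ := Env.exists_conj V hU hc
  refine ⟨Env, U', hU', hc', ?_⟩
  rw [hev, ← sub_mul, ← mul_sub]
  refine (traceNorm_conj_le _ V).trans (le_trans ?_ hδε)
  gcongr

theorem CommutingMacro.meanEnergy_lt_of_conj {β e : ℝ} {H : Matrix n n ℂ} (V : unitaryGroup n ℂ)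
    (h : ∀ ρf, CommutingMacro β e H ρf → meanEnergy H ρf < e) {ρf : Matrix n n ℂ}
    (hρ : CommutingMacro β e ((V : Matrix n n ℂ) * H * (V : Matrix n n ℂ)ᴴ) ρf) :
    meanEnergy ((V : Matrix n n ℂ) * H * (V : Matrix n n ℂ)ᴴ) ρf < e := by
  have h1 := hρ.conj (star V)
  have h3 : ((star V : unitaryGroup n ℂ) : Matrix n n ℂ) *
      ((V : Matrix n n ℂ) * H * (V : Matrix n n ℂ)ᴴ) *
      ((star V : unitaryGroup n ℂ) : Matrix n n ℂ)ᴴ = H := by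
    have := conj_conj_star H (star V)
    rwa [star_star] at this
  have h4 := meanEnergy_conj ((V : Matrix n n ℂ) * H * (V : Matrix n n ℂ)ᴴ) ρf (star V)
  rw [h3] at h1 h4
  rw [← h4]
  exact h _ h1

end Conjugation

/-! ### Conclusion -/

/-- Three energy levels make the macrostate strictly weaker than the canonical ensemble. -/
theorem exists_macrostate_weaker_than_gibbs {E : n → ℝ} {lo mid hi : n} (hlo : ∀ j, E lo ≤ E j)
    (hhi : ∀ j, E j ≤ E hi) (hlm : E lo < E mid) (hmh : E mid < E hi) (β : ℝ)
    (V : unitaryGroup n ℂ) {H : Matrix n n ℂ}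
    (hH : H = (V : Matrix n n ℂ) * diagHam E * (V : Matrix n n ℂ)ᴴ) :
    ∃ (e : ℝ) (γ : Matrix n n ℂ), IsCanonicalEnsemble H e γ ∧ ¬ CommutingEquiv β e H γ ∧
      ∃ a b : ℝ, IsGreatest (meanEnergy H '' {ρf | CommutingMacro β e H ρf}) a ∧
        IsGreatest (meanEnergy H '' {ρf | CommutingMicro β H γ ρf}) b ∧ a < b := by
  have : Nonempty n := ⟨lo⟩
  have hHerm : H.IsHermitian := by
    rw [hH]
    exact isHermitian_mul_mul_conjTranspose _ (diagHam_isHermitian E)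
  -- Any inverse temperature below `β` would do: it puts `e` above the thermal energy at `β`.
  set γ := gibbs (β - 1) H with hγ
  have he : meanEnergy H γ = ∑ j, boltzmann (β - 1) E j * E j := by
    rw [hγ, hH, gibbs_conj, meanEnergy_conj, gibbs_diagHam, meanEnergy_diagHam]
    simp [diagHam]
  set e := meanEnergy H γ with hedef
  have hlt : ∀ ρf, CommutingMacro β e H ρf → meanEnergy H ρf < e := by
    rw [hH]
    intro ρf hρf
    refine CommutingMacro.meanEnergy_lt_of_conj V (fun σ hσ => ?_) hρf
    refine hσ.meanEnergy_lt hlo hhi hlm hmh (boltzmann_pos (β - 1) E) (sum_boltzmann _ _) he.symm ?_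
    rw [he]
    exact sum_boltzmann_mul_lt (by linarith) (hlm.trans hmh)
  have hne : {ρf | CommutingMacro β e H ρf}.Nonempty := by
    refine ⟨(V : Matrix n n ℂ) * gibbs β (diagHam E) * (V : Matrix n n ℂ)ᴴ, ?_⟩
    rw [Set.mem_ofPred_eq, hH]
    exact (commutingMacro_gibbs β e E).conj V
  have hself : CommutingMicro β H γ γ := commutingMicro_self β (isDensity_gibbs hHerm _)
  obtain ⟨a, ha⟩ := exists_isGreatest_meanEnergy H hne (fun ρ h => h.1)
    fun ρ => CommutingMacro.of_near
  obtain ⟨b, hb⟩ := exists_isGreatest_meanEnergy H (S := {ρf | CommutingMicro β H γ ρf})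
    ⟨γ, hself⟩ (fun ρ h => h.1) fun ρ => CommutingMicro.of_near
  refine ⟨e, γ, ⟨β - 1, rfl, rfl⟩, fun hequiv => ?_, a, b, ha, hb, ?_⟩
  · exact lt_irrefl _ (hlt γ ((hequiv γ).mpr hself))
  · obtain ⟨ρ, hρ, rfl⟩ := ha.1
    exact (hlt ρ hρ).trans_le (hb.2 ⟨γ, hself, rfl⟩)

theorem exists_three_levels {E : n → ℝ} (h : 3 ≤ (Set.range E).ncard) :
    ∃ lo mid hi, (∀ j, E lo ≤ E j) ∧ (∀ j, E j ≤ E hi) ∧ E lo < E mid ∧ E mid < E hi := by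
  have hne : Nonempty n := by
    by_contra hcon
    rw [not_nonempty_iff] at hcon
    simp [Set.range_eq_empty] at h
  obtain ⟨lo, hlo⟩ := Finite.exists_min E
  obtain ⟨hi, hhi⟩ := Finite.exists_max E
  -- The extreme levels account for at most two of the at least three values.
  obtain ⟨x, ⟨mid, rfl⟩, hx⟩ := Set.exists_mem_notMem_of_ncard_lt_ncard
    (s := {E lo, E hi}) (t := Set.range E) (by
      have := Set.ncard_insert_le (E lo) {E hi}
      rw [Set.ncard_singleton] at this
      omega)
  simp only [Set.mem_insert_iff, Set.mem_singleton_iff, not_or] at hx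
  exact ⟨lo, mid, hi, hlo, hhi, lt_of_le_of_ne (hlo mid) (Ne.symm hx.1),
    lt_of_le_of_ne (hhi mid) hx.2⟩

end ExactEnergy

theorem mainTheorem3 {d : ℕ} (H : Matrix (Fin d) (Fin d) ℂ) (hH : H.IsHermitian)
    (hnontriv : 3 ≤ (spectrum ℝ H).ncard) (β : ℝ) :
    ∃ (e : ℝ) (γ : Matrix (Fin d) (Fin d) ℂ),
      ExactEnergy.IsCanonicalEnsemble H e γ ∧
      ¬ ExactEnergy.CommutingEquiv β e H γ ∧
      ∃ a b : ℝ,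
        IsGreatest (ExactEnergy.meanEnergy H '' {ρf | ExactEnergy.CommutingMacro β e H ρf}) a ∧
        IsGreatest (ExactEnergy.meanEnergy H '' {ρf | ExactEnergy.CommutingMicro β H γ ρf}) b ∧
        a < b := by
  rw [hH.spectrum_real_eq_range_eigenvalues] at hnontriv
  obtain ⟨lo, mid, hi, hlo, hhi, hlm, hmh⟩ := ExactEnergy.exists_three_levels hnontriv
  refine ExactEnergy.exists_macrostate_weaker_than_gibbs hlo hhi hlm hmh β hH.eigenvectorUnitary ?_
  exact hH.spectral_theorem
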